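/- Setting. Let $r\ge 3$, $s_1\ge 1$, $s_2>0$ and let $z\in\mathbb R$. For a base point $x_0\in\mathbb R$ and a mesh width $h>0$ put $x_j=x_0+jh$ (also for half-integers $j$), and consider the stencil $x_{-r+1},\dots,x_{r-1}$. The data of $f$ are either point values $f_j=f(x_j)$, or cell averages $f_j=\frac1h\int_{x_{j-1/2}}^{x_{j+1/2}}f(x)\,dx$; the same one of the two types is used throughout. The reconstruction polynomial on $n$ consecutive nodes is the unique polynomial of degree less than $n$ that has the given data (point values, respectively cell averages) at these nodes. Let $p_i$, $0\le i\le r-1$, be the reconstruction polynomial on the substencil $\{x_{-r+1+i},\dots,x_i\}$, and $p$ the one on the whole stencil. Let $c_0,\dots,c_{r-1}>0$, $\sum_i c_i=1$, be the ideal linear weights, i.e. $\sum_{i=0}^{r-1}c_ip_i(x_{1/2})=p(x_{1/2})$ for all data and all such grids. For $\varepsilon>0$ define \[ I_i=\sum_{l=1}^{r-1}\int_{x_{-1/2}}^{x_{1/2}}h^{2l-1}\bigl(p_i^{(l)}(x)\bigr)^2\,dx,\qquad d_1=\Bigl(\sum_{j=-r+1}^{r-1}(-1)^{j+r-1}\binom{2r-2}{j+r-1}f_j\Bigr)^2,\qquad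 d_2=B^2-4AC, \] where $Aw^2+Bw+C$ is the $(2r-4)$-th derivative with respect to $w$ of $w\mapsto p(x_0+wh)$, and \[ d=\frac{d_1^{s_1}|d_2|^{s_1}}{d_1^{s_1}+|d_2|^{s_1}+\varepsilon},\qquad \alpha_i=c_i\Bigl(1+\frac{d}{I_i^{s_1}+\varepsilon}\Bigr)^{s_2},\qquad \omega_i=\frac{\alpha_i}{\alpha_0+\dots+\alpha_{r-1}}. \] The OWENO reconstruction is $q(x_{1/2})=\sum_{i=0}^{r-1}\omega_i\,p_i(x_{1/2})$. Theorem. Let $f:\mathbb R\to\mathbb R$ be of class $C^{2r-1}$ in a neighbourhood of $z$. Then \[ f(x_{1/2})-q(x_{1/2})=\mathcal O(h^{2r-1})+\mathcal O(\varepsilon^{s_2}), \] whether or not $z$ is a critical point of $f$, and whatever its order, for stencils with $x_0-z=\mathcal O(h)$. Precisely: for every $M\in\mathbb R$ there are constants $K$ and $h_0>0$ such that for all $0<h<h_0$, all $x_0$ with $|x_0-z|\le Mh$, and all $\varepsilon>0$, \[ \bigl|f(x_{1/2})-q(x_{1/2})\bigr|\le K\bigl(h^{2r-1}+\varepsilon^{s_2}\bigr).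 \] -/

import Mathlib

open Polynomial

namespace OWENO

/-- The two kinds of data a reconstruction can start from. -/
inductive DataKind where
  | pointValues
  | cellAverages

/-- The datum of `f` at the node `x` of a grid of mesh width `h`: the value `f x`, or the average of
`f` over the cell `[x - h/2, x + h/2]`. -/
noncomputable def sample (κ : DataKind) (h : ℝ) (f : ℝ → ℝ) (x : ℝ) : ℝ :=
  match κ with
  | .pointValues => f x
  | .cellAverages => (1 / h) * ∫ t in (x - h / 2)..(x + h / 2), f t

/-- Lagrange interpolation polynomial (degree `< n`) with value `V l` at the point
`a + l * h`, for `l = 0, …, n - 1`. -/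
noncomputable def gridInterp (a h : ℝ) (n : ℕ) (V : ℕ → ℝ) : ℝ[X] :=
  Lagrange.interpolate (Finset.range n) (fun l : ℕ => a + l * h) V

/-- The reconstruction polynomial of degree `< n` on the `n` nodes `x₀ + j * h`,
`j = m, …, m + n - 1`, for data `F j`. For cell averages it is the derivative of
the polynomial that interpolates, at the `n + 1` cell interfaces, the primitive of the data.
The characterization is `reconPoly_degree_lt` with `reconPoly_sample` and `reconPoly_unique`. -/
noncomputable def reconPoly (κ : DataKind) (x₀ h : ℝ) (m : ℤ) (n : ℕ) (F : ℤ → ℝ) : ℝ[X] :=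
  match κ with
  | .pointValues => gridInterp (x₀ + m * h) h n (fun l => F (m + l))
  | .cellAverages =>
      derivative (gridInterp (x₀ + m * h - h / 2) h (n + 1)
        (fun l => h * ∑ t ∈ Finset.range l, F (m + t)))

/-- `p_{r,i}`: reconstruction polynomial on the substencil `x_{-r+1+i}, …, x_i`. -/
noncomputable def subPoly (κ : DataKind) (r : ℕ) (x₀ h : ℝ) (F : ℤ → ℝ) (i : ℕ) : ℝ[X] :=
  reconPoly κ x₀ h (-(r : ℤ) + 1 + i) r F

/-- Reconstruction polynomial on the whole stencil `x_{-r+1}, …, x_{r-1}`. -/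
noncomputable def fullPoly (κ : DataKind) (r : ℕ) (x₀ h : ℝ) (F : ℤ → ℝ) : ℝ[X] :=
  reconPoly κ x₀ h (-(r : ℤ) + 1) (2 * r - 1) F

/-- `c_0, …, c_{r-1}` are the ideal linear weights: positive, of sum one, and such that, on every
uniform grid and for all data, the combination of the `p_{r,i}` at `x_{1/2}` is the value there of
the reconstruction polynomial of the whole stencil. -/
structure IsIdealWeights (κ : DataKind) (r : ℕ) (c : ℕ → ℝ) : Prop where
  pos : ∀ i < r, 0 < c i
  sum_eq_one : ∑ i ∈ Finset.range r, c i = 1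
  ideal : ∀ (x₀ h : ℝ), 0 < h → ∀ F : ℤ → ℝ,
    ∑ i ∈ Finset.range r, c i * (subPoly κ r x₀ h F i).eval (x₀ + h / 2)
      = (fullPoly κ r x₀ h F).eval (x₀ + h / 2)

/-- Jiang–Shu smoothness indicator `I_i`. -/
noncomputable def smoothInd (κ : DataKind) (r : ℕ) (x₀ h : ℝ) (F : ℤ → ℝ) (i : ℕ) : ℝ :=
  ∑ l ∈ Finset.Icc 1 (r - 1), ∫ x in (x₀ - h / 2)..(x₀ + h / 2),
    h ^ (2 * l - 1) * ((derivative^[l] (subPoly κ r x₀ h F i)).eval x) ^ 2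

/-- `d₁`: squared undivided difference of order `2r-2` of `F (-r+1), …, F (r-1)`. -/
noncomputable def dOne (r : ℕ) (F : ℤ → ℝ) : ℝ :=
  (∑ j ∈ Finset.range (2 * r - 1),
    (-1) ^ j * ((2 * r - 2).choose j : ℝ) * F (-(r : ℤ) + 1 + j)) ^ 2

/-- The parabola `P_h^{(2r-4)}`, where `P_h(w) = p_h(x₀ + w h)` and `p_h` is the reconstruction
polynomial of the whole stencil. -/
noncomputable def parabola (κ : DataKind) (r : ℕ) (x₀ h : ℝ) (F : ℤ → ℝ) : ℝ[X] :=
  derivative^[2 * r - 4] ((fullPoly κ r x₀ h F).comp (C x₀ + C h * X))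

/-- `d₂ = B² - 4AC`, the discriminant of the parabola `A w² + B w + C`. -/
noncomputable def dTwo (κ : DataKind) (r : ℕ) (x₀ h : ℝ) (F : ℤ → ℝ) : ℝ :=
  (parabola κ r x₀ h F).coeff 1 ^ 2
    - 4 * (parabola κ r x₀ h F).coeff 2 * (parabola κ r x₀ h F).coeff 0

/-- `d = d₁^{s₁} |d₂|^{s₁} / (d₁^{s₁} + |d₂|^{s₁} + ε)`. -/
noncomputable def dTerm (κ : DataKind) (r : ℕ) (s₁ ε x₀ h : ℝ) (F : ℤ → ℝ) : ℝ :=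
  (dOne r F ^ s₁ * |dTwo κ r x₀ h F| ^ s₁)
    / (dOne r F ^ s₁ + |dTwo κ r x₀ h F| ^ s₁ + ε)

/-- `α_i = c_i (1 + d / (I_i^{s₁} + ε))^{s₂}`. -/
noncomputable def alphaWeight (κ : DataKind) (r : ℕ) (c : ℕ → ℝ) (s₁ s₂ ε x₀ h : ℝ)
    (F : ℤ → ℝ) (i : ℕ) : ℝ :=
  c i * (1 + dTerm κ r s₁ ε x₀ h F / (smoothInd κ r x₀ h F i ^ s₁ + ε)) ^ s₂

/-- `ω_i = α_i / (α_0 + ⋯ + α_{r-1})`. -/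
noncomputable def omegaWeight (κ : DataKind) (r : ℕ) (c : ℕ → ℝ) (s₁ s₂ ε x₀ h : ℝ)
    (F : ℤ → ℝ) (i : ℕ) : ℝ :=
  alphaWeight κ r c s₁ s₂ ε x₀ h F i
    / ∑ j ∈ Finset.range r, alphaWeight κ r c s₁ s₂ ε x₀ h F j

/-- The OWENO reconstruction `q(x_{1/2}) = ∑ ω_i p_i(x_{1/2})`, `x_{1/2} = x₀ + h/2`. -/
noncomputable def recon (κ : DataKind) (r : ℕ) (c : ℕ → ℝ) (s₁ s₂ ε x₀ h : ℝ)
    (F : ℤ → ℝ) : ℝ :=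
  ∑ i ∈ Finset.range r,
    omegaWeight κ r c s₁ s₂ ε x₀ h F i * (subPoly κ r x₀ h F i).eval (x₀ + h / 2)

/-- The data `f_j` of `f` on the grid `x_j = x₀ + j h`. -/
noncomputable def gridData (κ : DataKind) (f : ℝ → ℝ) (x₀ h : ℝ) (j : ℤ) : ℝ :=
  sample κ h f (x₀ + j * h)

/-! Facts that justify the definitions. -/

theorem gridNodes_injective (a : ℝ) {h : ℝ} (hh : 0 < h) (s : Set ℕ) :
    Set.InjOn (fun l : ℕ => a + l * h) s := by
  intro x _ y _ hxy
  have : (x : ℝ) * h = y * h := by simpa using hxy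
  exact_mod_cast mul_right_cancel₀ hh.ne' this

theorem gridInterp_eval (a : ℝ) {h : ℝ} (hh : 0 < h) (n : ℕ) (V : ℕ → ℝ) {l : ℕ} (hl : l < n) :
    (gridInterp a h n V).eval (a + l * h) = V l :=
  Lagrange.eval_interpolate_at_node (v := fun l : ℕ => a + l * h) V
    (gridNodes_injective a hh _) (Finset.mem_range.2 hl)

theorem gridInterp_degree_lt (a : ℝ) {h : ℝ} (hh : 0 < h) (n : ℕ) (V : ℕ → ℝ) :
    (gridInterp a h n V).degree < n := by
  have := Lagrange.degree_interpolate_lt (s := Finset.range n) (v := fun l : ℕ => a + l * h) V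
    (gridNodes_injective a hh _)
  rwa [Finset.card_range] at this

theorem gridInterp_unique (a : ℝ) {h : ℝ} (hh : 0 < h) (n : ℕ) (V : ℕ → ℝ) (p : ℝ[X])
    (hp : p.degree < n) (hV : ∀ l < n, p.eval (a + l * h) = V l) : p = gridInterp a h n V :=
  Lagrange.eq_interpolate_of_eval_eq (v := fun l : ℕ => a + l * h) V (gridNodes_injective a hh _)
    (by simpa using hp) (fun l hl => hV l (Finset.mem_range.1 hl))

theorem reconPoly_degree_lt (κ : DataKind) (x₀ : ℝ) {h : ℝ} (hh : 0 < h) (m : ℤ) (n : ℕ)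
    (F : ℤ → ℝ) : (reconPoly κ x₀ h m n F).degree < n := by
  cases κ with
  | pointValues => exact gridInterp_degree_lt _ hh _ _
  | cellAverages =>
    have h1 := gridInterp_degree_lt (x₀ + m * h - h / 2) hh (n + 1)
      (fun l => h * ∑ t ∈ Finset.range l, F (m + t))
    simp only [reconPoly]
    rw [degree_lt_iff_coeff_zero] at h1 ⊢
    intro k hk
    rw [coeff_derivative, h1 (k + 1) (by omega), zero_mul]

theorem reconPoly_sample (κ : DataKind) (x₀ : ℝ) {h : ℝ} (hh : 0 < h) (m : ℤ) (n : ℕ)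
    (F : ℤ → ℝ) {l : ℕ} (hl : l < n) :
    sample κ h (fun x => (reconPoly κ x₀ h m n F).eval x) (x₀ + (m + l : ℤ) * h) = F (m + l) := by
  cases κ with
  | pointValues =>
    have := gridInterp_eval (x₀ + m * h) hh n (fun l => F (m + l)) hl
    simp only [sample, reconPoly]
    rw [← this]
    push_cast
    ring_nf
  | cellAverages =>
    set V : ℕ → ℝ := fun l => h * ∑ t ∈ Finset.range l, F (m + t) with hV
    set P := gridInterp (x₀ + m * h - h / 2) h (n + 1) V with hP
    have h0 : P.eval (x₀ + m * h - h / 2 + l * h) = V l := gridInterp_eval _ hh _ _ (by omega)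
    have h1 : P.eval (x₀ + m * h - h / 2 + (l + 1 : ℕ) * h) = V (l + 1) :=
      gridInterp_eval _ hh _ _ (by omega)
    have hint : ∫ t in (x₀ + (m + l : ℤ) * h - h / 2)..(x₀ + (m + l : ℤ) * h + h / 2),
        (derivative P).eval t = P.eval (x₀ + (m + l : ℤ) * h + h / 2)
          - P.eval (x₀ + (m + l : ℤ) * h - h / 2) :=
      intervalIntegral.integral_eq_sub_of_hasDerivAt (fun x _ => P.hasDerivAt x)
        ((derivative P).continuous.intervalIntegrable _ _)
    have e0 : x₀ + (m + l : ℤ) * h - h / 2 = x₀ + m * h - h / 2 + l * h := by push_cast; ring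
    have e1 : x₀ + (m + l : ℤ) * h + h / 2 = x₀ + m * h - h / 2 + (l + 1 : ℕ) * h := by
      push_cast; ring
    simp only [sample, reconPoly]
    rw [hint, e0, e1, h0, h1, hV]
    simp only [Finset.sum_range_succ]
    field_simp
    ring

theorem exists_antiderivative (p : ℝ[X]) (n : ℕ) (hp : p.degree < n) :
    ∃ Q : ℝ[X], derivative Q = p ∧ Q.degree < (n + 1 : ℕ) := by
  refine ⟨∑ k ∈ Finset.range n, monomial (k + 1) (p.coeff k / (k + 1)), ?_, ?_⟩
  · have h1 : ∀ k ∈ Finset.range n,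
        derivative (monomial (k + 1) (p.coeff k / ((k : ℝ) + 1))) = monomial k (p.coeff k) := by
      intro k _
      have : (k : ℝ) + 1 ≠ 0 := by positivity
      rw [derivative_monomial]
      push_cast
      rw [div_mul_cancel₀ _ this]
    rw [derivative_sum, Finset.sum_congr rfl h1]
    by_cases h0 : p = 0
    · simp [h0]
    · exact (p.as_sum_range' n ((natDegree_lt_iff_degree_lt h0).2 hp)).symm
  · rw [← mem_degreeLT]
    refine Submodule.sum_mem _ fun k hk => mem_degreeLT.2 ?_
    refine lt_of_le_of_lt (degree_monomial_le _ _) ?_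
    exact_mod_cast Nat.succ_lt_succ (Finset.mem_range.1 hk)

/-- `reconPoly` is the only polynomial of degree `< n` that has the given data. -/
theorem reconPoly_unique (κ : DataKind) (x₀ : ℝ) {h : ℝ} (hh : 0 < h) (m : ℤ) (n : ℕ)
    (F : ℤ → ℝ) (p : ℝ[X]) (hp : p.degree < n)
    (hF : ∀ l < n, sample κ h (fun x => p.eval x) (x₀ + (m + l : ℤ) * h) = F (m + l)) :
    p = reconPoly κ x₀ h m n F := by
  cases κ with
  | pointValues =>
    refine gridInterp_unique _ hh _ _ _ hp fun l hl => ?_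
    have := hF l hl
    simp only [sample] at this
    rw [← this]
    push_cast
    ring_nf
  | cellAverages =>
    obtain ⟨Q, hQ, hQd⟩ := exists_antiderivative p n hp
    set a : ℝ := x₀ + m * h - h / 2 with ha
    have key : Q - C (Q.eval a) = gridInterp a h (n + 1)
        (fun l => h * ∑ t ∈ Finset.range l, F (m + t)) := by
      refine gridInterp_unique _ hh _ _ _ ?_ ?_
      · rw [← mem_degreeLT] at hQd ⊢
        refine Submodule.sub_mem _ hQd (mem_degreeLT.2 (lt_of_le_of_lt degree_C_le ?_))
        exact_mod_cast Nat.succ_pos n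
      · intro l hl
        induction l with
        | zero => simp
        | succ l ih =>
          have ih := ih (by omega)
          have hs := hF l (by omega)
          have hint : ∫ t in (x₀ + (m + l : ℤ) * h - h / 2)..(x₀ + (m + l : ℤ) * h + h / 2),
              p.eval t = Q.eval (x₀ + (m + l : ℤ) * h + h / 2)
                - Q.eval (x₀ + (m + l : ℤ) * h - h / 2) :=
            intervalIntegral.integral_eq_sub_of_hasDerivAt
              (fun x _ => by simpa [hQ] using Q.hasDerivAt x)
              (p.continuous.intervalIntegrable _ _)
          have e0 : x₀ + (m + l : ℤ) * h - h / 2 = a + l * h := by push_cast; ring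
          have e1 : x₀ + (m + l : ℤ) * h + h / 2 = a + (l + 1 : ℕ) * h := by push_cast; ring
          simp only [sample] at hs
          rw [hint, e0, e1] at hs
          have hs' : Q.eval (a + (l + 1 : ℕ) * h) - Q.eval (a + l * h) = h * F (m + l) := by
            rw [← hs]; field_simp
          rw [eval_sub, eval_C] at ih ⊢
          rw [Finset.sum_range_succ, mul_add, ← ih, ← hs']
          ring
    have h2 := congrArg derivative key
    rw [derivative_sub, derivative_C, sub_zero, hQ] at h2
    exact h2

theorem gridInterp_neville (a : ℝ) {h : ℝ} (hh : 0 < h) (n : ℕ) (hn : 0 < n) (V : ℕ → ℝ) :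
    gridInterp a h (n + 1) V = C ((n * h)⁻¹) * ((X - C a) * gridInterp (a + h) h n (fun l => V (l + 1))
      + (C (a + n * h) - X) * gridInterp a h n V) := by
  have hnh : (n : ℝ) * h ≠ 0 := by positivity
  symm
  refine gridInterp_unique _ hh _ _ _ ?_ ?_
  · have hlin : ∀ L G : ℝ[X], L.degree ≤ 1 → G.degree < n → (L * G).degree < (n + 1 : ℕ) := by
      intro L G hL hG
      rcases eq_or_ne G 0 with rfl | hG0
      · rw [mul_zero, degree_zero]; exact WithBot.bot_lt_coe _
      · rw [degree_eq_natDegree hG0] at hG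
        rw [degree_mul, degree_eq_natDegree hG0]
        have hG' : G.natDegree < n := by exact_mod_cast hG
        calc L.degree + (G.natDegree : WithBot ℕ) ≤ 1 + (G.natDegree : WithBot ℕ) := by gcongr
          _ < (n + 1 : ℕ) := by
            have : 1 + G.natDegree < n + 1 := by omega
            exact_mod_cast this
    rw [← smul_eq_C_mul, ← mem_degreeLT]
    refine Submodule.smul_mem _ _ ?_
    refine Submodule.add_mem _ (mem_degreeLT.2 ?_) (mem_degreeLT.2 ?_)
    · exact hlin _ _ (degree_X_sub_C_le _) (gridInterp_degree_lt _ hh _ _)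
    · refine hlin _ _ ?_ (gridInterp_degree_lt _ hh _ _)
      rw [← neg_sub, degree_neg]
      exact degree_X_sub_C_le _
  · intro l hl
    simp only [eval_mul, eval_add, eval_sub, eval_C, eval_X]
    have hA : ∀ k, l = k + 1 →
        (gridInterp (a + h) h n (fun l => V (l + 1))).eval (a + l * h) = V l := by
      rintro k rfl
      have := gridInterp_eval (a + h) hh n (fun l => V (l + 1)) (l := k) (by omega)
      rw [← this]
      push_cast
      ring_nf
    rcases Nat.eq_zero_or_pos l with rfl | hl0
    · have hB := gridInterp_eval a hh n V hn
      rw [hB]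
      field_simp
      push_cast
      ring
    · rw [hA (l - 1) (by omega)]
      rcases Nat.lt_succ_iff_lt_or_eq.1 hl with hl1 | rfl
      · rw [gridInterp_eval a hh n V hl1]
        field_simp
        ring
      · field_simp
        ring

theorem gridInterp_sub_const (a : ℝ) {h : ℝ} (hh : 0 < h) (n : ℕ) (hn : 0 < n) (V : ℕ → ℝ)
    (b : ℝ) : gridInterp a h n (fun l => V l - b) = gridInterp a h n V - C b := by
  symm
  refine gridInterp_unique _ hh _ _ _ ?_ ?_
  · rw [← mem_degreeLT]
    refine Submodule.sub_mem _ (mem_degreeLT.2 (gridInterp_degree_lt _ hh _ _))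
      (mem_degreeLT.2 (lt_of_le_of_lt degree_C_le ?_))
    exact_mod_cast hn
  · intro l hl
    rw [eval_sub, eval_C, gridInterp_eval a hh n V hl]

/-- One step of the recursion from substencils of `n` nodes to stencils of `n + 1` nodes. -/
theorem reconPoly_step (κ : DataKind) (m : ℤ) (n : ℕ) (hn : 0 < n) (hm : m ≤ -1)
    (hmn : 1 ≤ m + n) : ∃ u v : ℝ, 0 < u ∧ 0 < v ∧ u + v = 1 ∧
      ∀ (x₀ h : ℝ), 0 < h → ∀ F : ℤ → ℝ,
        (reconPoly κ x₀ h m (n + 1) F).eval (x₀ + h / 2)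
          = u * (reconPoly κ x₀ h (m + 1) n F).eval (x₀ + h / 2)
            + v * (reconPoly κ x₀ h m n F).eval (x₀ + h / 2) := by
  have hm' : (m : ℝ) ≤ -1 := by exact_mod_cast hm
  have hmn' : (1 : ℝ) ≤ m + n := by exact_mod_cast hmn
  have hn' : (0 : ℝ) < n := by exact_mod_cast hn
  cases κ with
  | pointValues =>
    refine ⟨(1 / 2 - m) / n, (m + n - 1 / 2) / n, div_pos (by linarith) hn',
      div_pos (by linarith) hn', by field_simp; ring, ?_⟩
    intro x₀ h hh F
    have hs : gridInterp (x₀ + (m + 1 : ℤ) * h) h n (fun l => F ((m + 1) + l))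
        = gridInterp (x₀ + m * h + h) h n (fun l => F (m + (l + 1 : ℕ))) := by
      congr 1
      · push_cast; ring
      · funext l; congr 1; push_cast; ring
    simp only [reconPoly]
    rw [gridInterp_neville _ hh n hn, hs]
    simp only [eval_mul, eval_add, eval_sub, eval_C, eval_X]
    field_simp
    ring
  | cellAverages =>
    refine ⟨(1 - m) / (n + 1), (m + n) / (n + 1), div_pos (by linarith) (by linarith),
      div_pos (by linarith) (by linarith), by field_simp; ring, ?_⟩
    intro x₀ h hh F
    obtain ⟨V, hV⟩ : ∃ V : ℕ → ℝ, V = fun l => h * ∑ t ∈ Finset.range l, F (m + t) := ⟨_, rfl⟩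
    have hs : gridInterp (x₀ + (m + 1 : ℤ) * h - h / 2) h (n + 1)
          (fun l => h * ∑ t ∈ Finset.range l, F ((m + 1) + t))
        = gridInterp (x₀ + m * h - h / 2 + h) h (n + 1) (fun l => V (l + 1)) - C (h * F m) := by
      rw [← gridInterp_sub_const _ hh _ (Nat.succ_pos n)]
      congr 1
      · push_cast; ring
      · funext l
        simp only [hV]
        rw [Finset.sum_range_succ', mul_add]
        simp only [Nat.cast_zero, add_zero, add_sub_cancel_right]
        congr 1
        refine Finset.sum_congr rfl fun t _ => ?_
        congr 1; push_cast; ring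
    set a : ℝ := x₀ + m * h - h / 2 with ha
    have hmid : ∀ k : ℕ, (k : ℤ) = 1 - m → a + k * h = x₀ + h / 2 := by
      intro k hk
      have : (k : ℝ) = 1 - m := by exact_mod_cast hk
      rw [this, ha]; ring
    obtain ⟨k, hk⟩ : ∃ k : ℕ, (k : ℤ) = -m := ⟨(-m).toNat, by omega⟩
    have v0 : (gridInterp a h (n + 1) V).eval (x₀ + h / 2) = V (k + 1) := by
      rw [← hmid (k + 1) (by push_cast; omega)]
      exact gridInterp_eval a hh _ _ (by omega)
    have v1 : (gridInterp (a + h) h (n + 1) (fun l => V (l + 1))).eval (x₀ + h / 2)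
        = V (k + 1) := by
      have e : x₀ + h / 2 = a + h + k * h := by
        rw [← hmid (k + 1) (by push_cast; omega)]; push_cast; ring
      rw [e]
      exact gridInterp_eval (a + h) hh _ (fun l => V (l + 1)) (by omega)
    simp only [reconPoly]
    rw [hs, ← hV, ← ha, gridInterp_neville a hh (n + 1) (Nat.succ_pos n)]
    generalize gridInterp (a + h) h (n + 1) (fun l => V (l + 1)) = G1 at v1 ⊢
    generalize gridInterp a h (n + 1) V = G0 at v0 ⊢
    simp only [derivative_mul, derivative_add, derivative_sub, derivative_C, derivative_X,
      eval_mul, eval_add, eval_sub, eval_C, eval_X, eval_zero, eval_one, v0, v1]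
    rw [ha]
    push_cast
    field_simp
    ring

theorem reconPoly_combination (κ : DataKind) (r : ℕ) (hr : 0 < r) (k : ℕ) : ∀ m : ℤ,
    -(r : ℤ) + 1 ≤ m → m + k ≤ 0 → ∃ w : ℕ → ℝ, (∀ i ≤ k, 0 < w i) ∧
      ∑ i ∈ Finset.range (k + 1), w i = 1 ∧
      ∀ (x₀ h : ℝ), 0 < h → ∀ F : ℤ → ℝ,
        ∑ i ∈ Finset.range (k + 1), w i * (reconPoly κ x₀ h (m + i) r F).eval (x₀ + h / 2)
          = (reconPoly κ x₀ h m (r + k) F).eval (x₀ + h / 2) := by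
  induction k with
  | zero =>
    intro m _ _
    exact ⟨fun _ => 1, by simp, by simp, by simp⟩
  | succ k ih =>
    intro m hm1 hm2
    push_cast at hm2
    obtain ⟨w0, p0, s0, e0⟩ := ih m hm1 (by omega)
    obtain ⟨w1, p1, s1, e1⟩ := ih (m + 1) (by omega) (by omega)
    obtain ⟨u, v, hu, hv, huv, hstep⟩ :=
      reconPoly_step κ m (r + k) (by omega) (by omega) (by push_cast; omega)
    have comb : ∀ g : ℕ → ℝ, ∑ i ∈ Finset.range (k + 1 + 1),
        ((if i = 0 then 0 else u * w1 (i - 1)) + (if i ≤ k then v * w0 i else 0)) * g i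
        = u * (∑ i ∈ Finset.range (k + 1), w1 i * g (i + 1))
          + v * ∑ i ∈ Finset.range (k + 1), w0 i * g i := by
      intro g
      simp only [add_mul, Finset.sum_add_distrib]
      congr 1
      · rw [Finset.sum_range_succ', Finset.mul_sum]
        simp [mul_assoc]
      · rw [Finset.sum_range_succ, Finset.mul_sum]
        simp only [Nat.not_succ_le_self, if_false, zero_mul, add_zero]
        refine Finset.sum_congr rfl fun i hi => ?_
        rw [if_pos (Nat.lt_succ_iff.1 (Finset.mem_range.1 hi)), mul_assoc]
    refine ⟨fun i => (if i = 0 then 0 else u * w1 (i - 1)) + (if i ≤ k then v * w0 i else 0),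
      ?_, ?_, ?_⟩
    · intro i hi
      by_cases h0 : i = 0
      · subst h0
        simpa using mul_pos hv (p0 0 (by omega))
      · have h1 : 0 < u * w1 (i - 1) := mul_pos hu (p1 _ (by omega))
        by_cases h2 : i ≤ k
        · simpa [h0, h2] using add_pos h1 (mul_pos hv (p0 i h2))
        · simpa [h0, h2] using h1
    · have := comb (fun _ => 1)
      simp only [mul_one] at this
      rw [this, s0, s1, mul_one, mul_one, huv]
    · intro x₀ h hh F
      have e2 : ∑ i ∈ Finset.range (k + 1),
          w1 i * (reconPoly κ x₀ h (m + (i + 1 : ℕ)) r F).eval (x₀ + h / 2)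
          = (reconPoly κ x₀ h (m + 1) (r + k) F).eval (x₀ + h / 2) := by
        rw [← e1 x₀ h hh F]
        refine Finset.sum_congr rfl fun i _ => ?_
        rw [show m + ((i + 1 : ℕ) : ℤ) = m + 1 + (i : ℤ) by push_cast; ring]
      have e3 := comb (fun i => (reconPoly κ x₀ h (m + i) r F).eval (x₀ + h / 2))
      rw [e0 x₀ h hh F, e2, ← hstep x₀ h hh F] at e3
      exact e3

/-- Ideal linear weights exist. -/
theorem exists_isIdealWeights (κ : DataKind) (r : ℕ) (hr : 0 < r) :
    ∃ c : ℕ → ℝ, IsIdealWeights κ r c := by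
  obtain ⟨w, hpos, hsum, hid⟩ := reconPoly_combination κ r hr (r - 1) (-(r : ℤ) + 1) le_rfl
    (by omega)
  rw [Nat.sub_add_cancel hr] at hsum
  refine ⟨w, fun i hi => hpos i (by omega), hsum, fun x₀ h hh F => ?_⟩
  have := hid x₀ h hh F
  rw [Nat.sub_add_cancel hr, show r + (r - 1) = 2 * r - 1 by omega] at this
  exact this

end OWENO

/-!
In the grid variable `w = (x - x₀) / h` every reconstruction polynomial is a fixed linear function
of the data, namely the one of the unit grid (`reconPoly_comp`), so it is bounded by the data and
reproduces polynomials. Write the Taylor expansion of `f` at `z` with coefficients `a t`. The full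
stencil reproduces its part of degree `≤ 2 * r - 2`, and `f - p = O(h ^ (2 * r - 1))` at `x_{1/2}`
(`HasTaylorExpansion.exists_abs_sub_fullPoly_le`). As the nonlinear and the ideal weights both have
sum one,
`q - p = ∑ i, (ω i - c i) * (p i - a 0)` at `x_{1/2}`.

Let `m ≥ 1` be the order of the first nonzero Taylor coefficient after `a 0`. Then
`p i - a 0 = O(h ^ m)`, which is enough if `m ≥ 2 * r - 1`, because `|ω i - c i| ≤ 1`. Otherwise
`ω i - c i = O(min d₁ |d₂| / I i)` (`abs_omegaWeight_sub_le`), uniformly in `ε`, since a positive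
`ε` only draws the weights towards the ideal ones. Denominator and numerator are estimated thus.

* `I i ≥ b * h ^ (2 * m)` with `b > 0` (`HasTaylorExpansion.exists_pow_le_smoothInd`). To leading
  order the data are those of `a m * h ^ m * (w + θ) ^ m` with `θ = (x₀ - z) / h`. They take no
  common value at three consecutive nodes, so the derivative of the reconstruction does not vanish,
  and `b` is found by compactness, because `θ` stays bounded.
* If `m ≤ 2 * r - 3`, then `d₁ = O(h ^ (4 * r - 4))`, because differences of order `2 * r - 2`
  annihilate polynomials of smaller degree. The error is `O(h ^ (4 * r - 4 - m))`.
* If `m = 2 * r - 2`, this loses one order, but then the derivative of `p` of order `2 * r - 4` in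
  `w` is, to leading order, a multiple of the square `(w + θ) ^ 2`, whose discriminant vanishes. Hence
  `d₂ = O(h ^ (4 * r - 3))`, and `d₂ / I i = O(h)` restores the order.
-/

open Polynomial

namespace OWENO

/-! ### Taylor expansion -/

theorem exists_taylor_isBigO {f : ℝ → ℝ} {z : ℝ} {N : ℕ} (hf : ContDiffAt ℝ N f z) :
    ∃ a : ℕ → ℝ, ∀ k ≤ N, (fun x => f x - ∑ t ∈ Finset.range k, a t * (x - z) ^ t)
      =O[nhds z] fun x => (x - z) ^ k := by
  obtain ⟨u, hu, hfu⟩ := hf.contDiffOn le_rfl (by simp)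
  obtain ⟨δ, hδ, hball⟩ := Metric.mem_nhds_iff.1 hu
  have hT := taylor_isLittleO (convex_ball z δ) (Metric.mem_ball_self hδ)
    (hfu.mono (by simpa using hball))
  rw [nhdsWithin_eq_nhds.2 (Metric.ball_mem_nhds z hδ)] at hT
  have hpow : ∀ {k t : ℕ}, k ≤ t →
      (fun x : ℝ => (x - z) ^ t) =O[nhds z] fun x => (x - z) ^ k := by
    intro k t hkt
    have h1 : (fun x : ℝ => (x - z) ^ (t - k)) =O[nhds z] fun _ => (1 : ℝ) :=
      ((by fun_prop : Continuous fun x : ℝ => (x - z) ^ (t - k)).tendsto z).isBigO_one ℝ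
    have h2 := h1.mul (Asymptotics.isBigO_refl (fun x : ℝ => (x - z) ^ k) (nhds z))
    simpa only [← pow_add, Nat.sub_add_cancel hkt, one_mul] using h2
  refine ⟨fun t => ((t.factorial : ℝ))⁻¹ * iteratedDerivWithin t f (Metric.ball z δ) z,
    fun k hk => ?_⟩
  have hsum : (fun x => ∑ t ∈ Finset.Ico k (N + 1),
      ((t.factorial : ℝ))⁻¹ * iteratedDerivWithin t f (Metric.ball z δ) z * (x - z) ^ t)
      =O[nhds z] fun x => (x - z) ^ k :=
    Asymptotics.IsBigO.fun_sum fun t ht => (hpow (Finset.mem_Ico.1 ht).1).const_mul_left _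
  refine ((hT.isBigO.trans (hpow hk)).add hsum).congr_left fun x => ?_
  rw [taylor_within_apply, ← Finset.sum_range_add_sum_Ico _ (by omega : k ≤ N + 1)]
  simp only [smul_eq_mul, mul_right_comm _ ((x - z) ^ _)]
  ring

/-! ### Data of a function -/

theorem sample_rescale (κ : DataKind) {h : ℝ} (hh : 0 < h) (f : ℝ → ℝ) (x₀ y : ℝ) :
    sample κ h f (x₀ + y * h) = sample κ 1 (fun w => f (x₀ + h * w)) y := by
  cases κ with
  | pointValues => simp only [sample]; rw [mul_comm]
  | cellAverages =>
    simp only [sample]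
    rw [intervalIntegral.integral_comp_add_mul _ hh.ne', smul_eq_mul]
    rw [show x₀ + h * (y - 1 / 2) = x₀ + y * h - h / 2 by ring,
      show x₀ + h * (y + 1 / 2) = x₀ + y * h + h / 2 by ring]
    simp

theorem sample_add (κ : DataKind) (h : ℝ) {f g : ℝ → ℝ} (hf : Continuous f) (hg : Continuous g)
    (x : ℝ) : sample κ h (fun t => f t + g t) x = sample κ h f x + sample κ h g x := by
  cases κ with
  | pointValues => rfl
  | cellAverages =>
    simp only [sample]
    rw [intervalIntegral.integral_add (hf.intervalIntegrable _ _) (hg.intervalIntegrable _ _),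
      mul_add]

theorem sample_const_mul (κ : DataKind) (h a : ℝ) (f : ℝ → ℝ) (x : ℝ) :
    sample κ h (fun t => a * f t) x = a * sample κ h f x := by
  cases κ with
  | pointValues => rfl
  | cellAverages =>
    simp only [sample]
    rw [intervalIntegral.integral_const_mul]
    ring

theorem sample_sum (κ : DataKind) (h : ℝ) {ι : Type*} (s : Finset ι) {f : ι → ℝ → ℝ}
    (hf : ∀ i, Continuous (f i)) (x : ℝ) :
    sample κ h (fun t => ∑ i ∈ s, f i t) x = ∑ i ∈ s, sample κ h (f i) x := by
  cases κ with
  | pointValues => rfl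
  | cellAverages =>
    simp only [sample]
    rw [intervalIntegral.integral_finsetSum fun i _ => (hf i).intervalIntegrable _ _,
      Finset.mul_sum]

theorem sample_const (κ : DataKind) {h : ℝ} (hh : 0 < h) (a x : ℝ) :
    sample κ h (fun _ => a) x = a := by
  cases κ with
  | pointValues => rfl
  | cellAverages =>
    simp only [sample, intervalIntegral.integral_const, smul_eq_mul]
    field_simp
    ring

theorem abs_sample_sub_le (κ : DataKind) {f g : ℝ → ℝ} {y B : ℝ}
    (hf : ContinuousOn f (Set.Icc (y - 1 / 2) (y + 1 / 2))) (hg : Continuous g)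
    (hB : ∀ w ∈ Set.Icc (y - 1 / 2) (y + 1 / 2), |f w - g w| ≤ B) :
    |sample κ 1 f y - sample κ 1 g y| ≤ B := by
  cases κ with
  | pointValues => exact hB y ⟨by linarith, by linarith⟩
  | cellAverages =>
    have hle : y - 1 / 2 ≤ y + 1 / 2 := by linarith
    simp only [sample, div_one, one_mul]
    rw [← intervalIntegral.integral_sub (hf.intervalIntegrable_of_Icc hle)
      (hg.intervalIntegrable _ _)]
    have := intervalIntegral.norm_integral_le_of_norm_le_const (a := y - 1 / 2) (b := y + 1 / 2)
      (C := B) (f := fun w => f w - g w) fun w hw => by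
        rw [Set.uIoc_of_le hle] at hw
        exact hB w ⟨hw.1.le, hw.2⟩
    rw [show y + 1 / 2 - (y - 1 / 2) = 1 by ring] at this
    simpa using this

/-! ### Reconstruction on the unit grid -/

/-- In the grid variable, reconstruction does not depend on the grid. -/
theorem reconPoly_comp (κ : DataKind) (x₀ : ℝ) {h : ℝ} (hh : 0 < h) (m : ℤ) (n : ℕ) (F : ℤ → ℝ) :
    (reconPoly κ x₀ h m n F).comp (C x₀ + C h * X) = reconPoly κ 0 1 m n F := by
  refine reconPoly_unique κ 0 one_pos m n F _ ?_ fun l hl => ?_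
  · have hd := reconPoly_degree_lt κ x₀ hh m n F
    rw [degree_lt_iff_coeff_zero]
    intro k hk
    refine coeff_eq_zero_of_degree_lt (lt_of_le_of_lt ?_ (hd.trans_le (by exact_mod_cast hk)))
    rcases eq_or_ne (reconPoly κ x₀ h m n F) 0 with h0 | h0
    · simp [h0]
    · refine degree_le_of_natDegree_le (natDegree_comp_le.trans ?_) |>.trans
        (degree_eq_natDegree h0).ge
      have : (C x₀ + C h * X : ℝ[X]).natDegree ≤ 1 := by compute_degree
      nlinarith
  · have := reconPoly_sample κ x₀ hh m n F hl
    rw [sample_rescale κ hh] at this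
    rw [← this]
    simp [eval_comp]

theorem eval_reconPoly_midpoint (κ : DataKind) (x₀ : ℝ) {h : ℝ} (hh : 0 < h) (m : ℤ) (n : ℕ)
    (F : ℤ → ℝ) : (reconPoly κ x₀ h m n F).eval (x₀ + h / 2)
      = (reconPoly κ 0 1 m n F).eval (1 / 2) := by
  rw [← reconPoly_comp κ x₀ hh, eval_comp]
  simp [div_eq_mul_inv]

theorem reconPoly_eq_sum (κ : DataKind) (m : ℤ) (n : ℕ) (F : ℤ → ℝ) :
    reconPoly κ 0 1 m n F
      = ∑ l ∈ Finset.range n, F (m + l) • reconPoly κ 0 1 m n (Pi.single (m + l) 1) := by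
  symm
  refine reconPoly_unique κ 0 one_pos m n F _ ?_ fun k hk => ?_
  · rw [← mem_degreeLT]
    exact Submodule.sum_mem _ fun l _ => Submodule.smul_mem _ _
      (mem_degreeLT.2 (reconPoly_degree_lt κ 0 one_pos m n _))
  · simp only [eval_finsetSum, eval_smul, smul_eq_mul]
    rw [sample_sum _ _ _ fun i => by fun_prop]
    simp only [sample_const_mul]
    have : ∀ l ∈ Finset.range n, F (m + l) * sample κ 1
        (fun x => (reconPoly κ 0 1 m n (Pi.single (m + l) 1)).eval x) (0 + (m + k : ℤ) * 1)
        = if k = l then F (m + l) else 0 := by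
      intro l _
      rw [reconPoly_sample κ 0 one_pos m n _ hk, Pi.single_apply]
      simp
    rw [Finset.sum_congr rfl this]
    simp [hk]

/-- Reconstruction on `n` nodes reproduces polynomials of degree `< n`. -/
theorem reconPoly_sample_eval (κ : DataKind) (m : ℤ) (n : ℕ) {q : ℝ[X]} (hq : q.degree < n) :
    reconPoly κ 0 1 m n (fun j => sample κ 1 (fun w => q.eval w) j) = q := by
  symm
  exact reconPoly_unique κ 0 one_pos m n _ q hq fun l _ => by simp

theorem reconPoly_sub (κ : DataKind) (m : ℤ) (n : ℕ) (F G : ℤ → ℝ) :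
    reconPoly κ 0 1 m n (fun j => F j - G j)
      = reconPoly κ 0 1 m n F - reconPoly κ 0 1 m n G := by
  rw [reconPoly_eq_sum κ m n F, reconPoly_eq_sum κ m n G, reconPoly_eq_sum,
    ← Finset.sum_sub_distrib]
  simp only [sub_smul]

theorem reconPoly_const_mul (κ : DataKind) (m : ℤ) (n : ℕ) (b : ℝ) (F : ℤ → ℝ) :
    reconPoly κ 0 1 m n (fun j => b * F j) = b • reconPoly κ 0 1 m n F := by
  rw [reconPoly_eq_sum κ m n F, reconPoly_eq_sum, Finset.smul_sum]
  simp only [mul_smul]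

theorem exists_abs_apply_reconPoly_le (κ : DataKind) (m : ℤ) (n : ℕ) (φ : ℝ[X] →ₗ[ℝ] ℝ) :
    ∃ K : ℝ, 0 ≤ K ∧ ∀ (F : ℤ → ℝ) (B : ℝ), (∀ l < n, |F (m + l)| ≤ B) →
      |φ (reconPoly κ 0 1 m n F)| ≤ K * B := by
  refine ⟨∑ l ∈ Finset.range n, |φ (reconPoly κ 0 1 m n (Pi.single (m + l) 1))|,
    Finset.sum_nonneg fun _ _ => abs_nonneg _, fun F B hF => ?_⟩
  rw [reconPoly_eq_sum, map_sum, Finset.sum_mul]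
  refine (Finset.abs_sum_le_sum_abs _ _).trans (Finset.sum_le_sum fun l hl => ?_)
  rw [map_smul, smul_eq_mul, abs_mul, mul_comm]
  exact mul_le_mul_of_nonneg_left (hF l (Finset.mem_range.1 hl)) (abs_nonneg _)

/-! ### The data of a smooth function near `z` -/

/-- The Taylor polynomial `∑ t < k, a t * (x - z) ^ t` in the grid variable `w`, where
`x = x₀ + h * w` and `θ = (x₀ - z) / h`. -/
noncomputable def scaledTaylor (a : ℕ → ℝ) (k : ℕ) (h θ : ℝ) : ℝ[X] :=
  ∑ t ∈ Finset.range k, C (a t * h ^ t) * (X + C θ) ^ t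

theorem scaledTaylor_degree_lt (a : ℕ → ℝ) (k : ℕ) (h θ : ℝ) :
    (scaledTaylor a k h θ).degree < k := by
  rw [← mem_degreeLT]
  refine Submodule.sum_mem _ fun t ht => mem_degreeLT.2 ?_
  have : (C (a t * h ^ t) * (X + C θ) ^ t).degree ≤ (t : WithBot ℕ) := by compute_degree!
  exact this.trans_lt (by exact_mod_cast Finset.mem_range.1 ht)

theorem scaledTaylor_eval (a : ℕ → ℝ) (k : ℕ) {h : ℝ} (hh : h ≠ 0) (x₀ z w : ℝ) :
    (scaledTaylor a k h ((x₀ - z) / h)).eval w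
      = ∑ t ∈ Finset.range k, a t * (x₀ + h * w - z) ^ t := by
  simp only [scaledTaylor, eval_finsetSum, eval_mul, eval_C, eval_pow, eval_add, eval_X, mul_assoc,
    ← mul_pow]
  congr! 3
  field_simp
  ring

theorem scaledTaylor_eq_add (a : ℕ → ℝ) {k m : ℕ} (hm : 1 ≤ m) (hmk : m < k)
    (ha : ∀ t, 1 ≤ t → t < k → t ≠ m → a t = 0) (h θ : ℝ) :
    scaledTaylor a k h θ = C (a 0) + C (a m * h ^ m) * (X + C θ) ^ m := by
  rw [scaledTaylor, ← Finset.sum_subset (s₁ := {0, m})]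
  · rw [Finset.sum_pair (by omega)]
    simp
  · intro t ht
    simp only [Finset.mem_insert, Finset.mem_singleton] at ht
    rcases ht with rfl | rfl <;> simp <;> omega
  · intro t ht ht'
    simp only [Finset.mem_insert, Finset.mem_singleton, not_or] at ht'
    rw [ha t (by omega) (Finset.mem_range.1 ht) ht'.2]
    simp

theorem scaledTaylor_eq_C (a : ℕ → ℝ) {k : ℕ} (hk : 1 ≤ k)
    (ha : ∀ t, 1 ≤ t → t < k → a t = 0) (h θ : ℝ) :
    scaledTaylor a k h θ = C (a 0) := by
  rw [scaledTaylor, ← Finset.sum_subset (s₁ := {0})]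
  · simp
  · exact Finset.singleton_subset_iff.2 (Finset.mem_range.2 hk)
  · intro t ht ht'
    rw [Finset.mem_singleton] at ht'
    rw [ha t (by omega) (Finset.mem_range.1 ht)]
    simp

theorem exists_abs_sample_sub_scaledTaylor_le (κ : DataKind) {f : ℝ → ℝ} {z : ℝ} {a : ℕ → ℝ}
    {k : ℕ} (hcont : ∀ᶠ x in nhds z, ContinuousAt f x)
    (hf : (fun x => f x - ∑ t ∈ Finset.range k, a t * (x - z) ^ t)
      =O[nhds z] fun x => (x - z) ^ k) (M R : ℝ) :
    ∃ K : ℝ, 0 ≤ K ∧ ∀ᶠ h in nhdsWithin (0 : ℝ) (Set.Ioi 0), ∀ x₀, |x₀ - z| ≤ M * h →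
      ∀ y, |y| ≤ R → |sample κ h f (x₀ + y * h)
        - sample κ 1 (fun w => (scaledTaylor a k h ((x₀ - z) / h)).eval w) y| ≤ K * h ^ k := by
  obtain ⟨K, hK, hKf⟩ := hf.exists_nonneg
  obtain ⟨δ, hδ, hball⟩ := Metric.eventually_nhds_iff.1 (hcont.and hKf.bound)
  set L : ℝ := |M| + |R| + 1 with hL
  have hLpos : 0 < L := by positivity
  refine ⟨K * L ^ k, by positivity, ?_⟩
  filter_upwards [Ioo_mem_nhdsGT (show 0 < δ / L by positivity)] with h ⟨hh, hhδ⟩ x₀ hx₀ y hy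
  rw [lt_div_iff₀ hLpos] at hhδ
  have hdist : ∀ w ∈ Set.Icc (y - 1 / 2) (y + 1 / 2), |x₀ + h * w - z| ≤ L * h := by
    intro w hw
    have h1 : |w| ≤ |R| + 1 := by
      have := abs_le.1 (hy.trans (le_abs_self R))
      exact abs_le.2 ⟨by linarith [hw.1], by linarith [hw.2]⟩
    calc |x₀ + h * w - z| = |(x₀ - z) + h * w| := by ring_nf
      _ ≤ |x₀ - z| + |h * w| := abs_add_le _ _
      _ ≤ |M| * h + h * (|R| + 1) := by
        rw [abs_mul, abs_of_pos hh]
        gcongr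
        exact hx₀.trans (by gcongr; exact le_abs_self M)
      _ = L * h := by rw [hL]; ring
  have hnear : ∀ w ∈ Set.Icc (y - 1 / 2) (y + 1 / 2), dist (x₀ + h * w) z < δ := fun w hw => by
    rw [Real.dist_eq]; linarith [hdist w hw]
  rw [sample_rescale κ hh]
  refine abs_sample_sub_le κ ?_ (by fun_prop) fun w hw => ?_
  · intro w hw
    exact ((hball (hnear w hw)).1.comp (f := fun w => x₀ + h * w)
      (by fun_prop)).continuousWithinAt
  · rw [scaledTaylor_eval a k hh.ne']
    have := (hball (hnear w hw)).2
    simp only [Real.norm_eq_abs, abs_pow] at this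
    refine this.trans ?_
    rw [mul_assoc, ← mul_pow]
    gcongr
    exact hdist w hw

/-! ### Undivided differences -/

/-- Undivided differences of order `n` of the data of a polynomial of degree `< n` vanish. Cell
averages of `q` are first differences of an antiderivative of `q`, shifted by half a cell. -/
theorem sum_choose_mul_sample_eval_eq_zero (κ : DataKind) {n : ℕ} {q : ℝ[X]} (hq : q.degree < n)
    (y : ℝ) : ∑ j ∈ Finset.range (n + 1), (-1) ^ j * (n.choose j : ℝ)
      * sample κ 1 (fun w => q.eval w) (y + j) = 0 := by
  have key : (fwdDiff 1)^[n] (fun y => sample κ 1 (fun w => q.eval w) y) y = 0 := by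
    cases κ with
    | pointValues =>
      rcases eq_or_ne q 0 with rfl | hq0
      · simp [sample, fwdDiff_iter_eq_sum_shift]
      · exact congrFun (Polynomial.fwdDiff_iter_eq_zero_of_degree_lt
          ((natDegree_lt_iff_degree_lt hq0).2 hq)) y
    | cellAverages =>
      obtain ⟨Q, hQ, hQd⟩ := exists_antiderivative q n hq
      have h1 : (fun y => sample .cellAverages 1 (fun w => q.eval w) y)
          = fwdDiff 1 (fun y => Q.eval (y + -(1 / 2))) := by
        funext y
        simp only [sample, fwdDiff]
        rw [intervalIntegral.integral_eq_sub_of_hasDerivAt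
          (fun x _ => by simpa [hQ] using Q.hasDerivAt x)
          (q.continuous.intervalIntegrable _ _)]
        ring_nf
      rw [h1, ← Function.iterate_succ_apply,
        fwdDiff_iter_comp_add 1 (fun y => Q.eval y) (-(1 / 2))]
      have hQn : Q.natDegree < n + 1 := by
        rcases eq_or_ne Q 0 with rfl | hQ0
        · simp
        · exact (natDegree_lt_iff_degree_lt hQ0).2 hQd
      exact congrFun (Polynomial.fwdDiff_iter_eq_zero_of_degree_lt hQn) _
  rw [fwdDiff_iter_eq_sum_shift] at key
  rw [← mul_zero ((-1 : ℝ) ^ n), ← key, Finset.mul_sum]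
  refine Finset.sum_congr rfl fun j hj => ?_
  have hj' : j ≤ n := Nat.lt_succ_iff.1 (Finset.mem_range.1 hj)
  have hs : (-1 : ℝ) ^ n * (-1) ^ (n - j) = (-1) ^ j := by
    rw [← pow_add, show n + (n - j) = j + 2 * (n - j) by omega, pow_add, pow_mul]
    simp
  rw [← hs]
  simp only [zsmul_eq_mul, nsmul_eq_mul, mul_one]
  push_cast
  ring

theorem dOne_le (κ : DataKind) {r : ℕ} (hr : 1 ≤ r) {q : ℝ[X]} (hq : q.degree < (2 * r - 2 : ℕ))
    {F : ℤ → ℝ} {B : ℝ} (hF : ∀ j < 2 * r - 1,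
      |F (-(r : ℤ) + 1 + j) - sample κ 1 (fun w => q.eval w) (-(r : ℤ) + 1 + j : ℤ)| ≤ B) :
    dOne r F ≤ (2 ^ (2 * r - 2) * B) ^ 2 := by
  have hz := sum_choose_mul_sample_eval_eq_zero κ hq ((-(r : ℤ) + 1 : ℤ) : ℝ)
  have hn : 2 * r - 2 + 1 = 2 * r - 1 := by omega
  rw [hn] at hz
  rw [dOne, ← sub_zero (Finset.sum _ _), ← hz, ← Finset.sum_sub_distrib]
  refine sq_le_sq' (neg_le_of_abs_le ?_) (le_of_abs_le ?_) <;>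
  · refine (Finset.abs_sum_le_sum_abs _ _).trans ?_
    have h2 : (2 : ℝ) ^ (2 * r - 2)
        = ∑ j ∈ Finset.range (2 * r - 1), ((2 * r - 2).choose j : ℝ) := by
      rw [← hn]; exact_mod_cast (Nat.sum_range_choose _).symm
    rw [h2, Finset.sum_mul]
    refine Finset.sum_le_sum fun j hj => ?_
    rw [← mul_sub, abs_mul, abs_mul]
    have := hF j (Finset.mem_range.1 hj)
    push_cast at this ⊢
    simpa using mul_le_mul_of_nonneg_left this (Nat.cast_nonneg ((2 * r - 2).choose j))

/-! ### Lower bound for the smoothness indicators -/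

/-- The data of a positive power take no common value at three consecutive nodes. For cell averages
this follows from Rolle's theorem, because the derivative `(y + 1/2) ^ p - (y - 1/2) ^ p` has a
single zero. -/
theorem not_sample_pow_const (κ : DataKind) {p : ℕ} (hp : 1 ≤ p) (y : ℝ)
    (h1 : sample κ 1 (fun w => w ^ p) y = sample κ 1 (fun w => w ^ p) (y + 1))
    (h2 : sample κ 1 (fun w => w ^ p) (y + 1) = sample κ 1 (fun w => w ^ p) (y + 2)) : False := by
  have hpow : ∀ u v : ℝ, u ^ p = v ^ p → u = v ∨ u = -v := by
    intro u v huv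
    refine abs_eq_abs.1 ((pow_left_inj₀ (n := p) (abs_nonneg u) (abs_nonneg v) (by omega)).1 ?_)
    rw [← abs_pow, ← abs_pow, huv]
  cases κ with
  | pointValues =>
    simp only [sample] at h1 h2
    rcases hpow _ _ h1 with h | h <;> rcases hpow _ _ h2 with h' | h' <;> linarith
  | cellAverages =>
    obtain ⟨G, hG⟩ : ∃ G : ℝ → ℝ, G = fun y => sample .cellAverages 1 (fun w => w ^ p) y :=
      ⟨_, rfl⟩
    have hp1 : (p : ℝ) + 1 ≠ 0 := by positivity
    have hder : ∀ y, HasDerivAt G ((y + 1 / 2) ^ p - (y - 1 / 2) ^ p) y := by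
      intro y
      have hGe : G = fun y : ℝ => ((y + 1 / 2) ^ (p + 1) - (y - 1 / 2) ^ (p + 1)) / (p + 1) := by
        rw [hG]; funext y; simp only [sample, integral_pow]; ring
      rw [hGe]
      have := ((((hasDerivAt_id y).add_const (1 / 2)).pow (p + 1)).sub
        (((hasDerivAt_id y).sub_const (1 / 2)).pow (p + 1))).div_const ((p : ℝ) + 1)
      refine this.congr_deriv ?_
      simp
      field_simp
    have hroot : ∀ y, G y = G (y + 1) → ∃ x ∈ Set.Ioo y (y + 1), x = 0 := by
      intro y hy
      obtain ⟨x, hx, hx0⟩ := exists_hasDerivAt_eq_zero (show y < y + 1 by linarith)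
        (fun t _ => (hder t).continuousAt.continuousWithinAt) hy fun t _ => hder t
      refine ⟨x, hx, ?_⟩
      rcases hpow _ _ (sub_eq_zero.1 hx0) with h | h <;> linarith
    obtain ⟨u, hu, hu0⟩ := hroot y (by simpa only [hG] using h1)
    obtain ⟨v, hv, hv0⟩ := hroot (y + 1) (by
      simp only [hG]; rw [h2]; congr 1; ring)
    linarith [hu.2, hv.1]

theorem sample_add_const_pow (κ : DataKind) (p : ℕ) (θ y : ℝ) :
    sample κ 1 (fun w => (w + θ) ^ p) y = sample κ 1 (fun w => w ^ p) (y + θ) := by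
  cases κ with
  | pointValues => rfl
  | cellAverages =>
    simp only [sample]
    rw [intervalIntegral.integral_comp_add_right (fun w => w ^ p)]
    ring_nf

theorem continuous_sample_add_const_pow (κ : DataKind) (p : ℕ) (y : ℝ) :
    Continuous fun θ : ℝ => sample κ 1 (fun w => (w + θ) ^ p) y := by
  cases κ with
  | pointValues => simp only [sample]; fun_prop
  | cellAverages =>
    simp only [sample]
    refine continuous_const.mul ?_
    exact intervalIntegral.continuous_parametric_intervalIntegral_of_continuous'
      (f := fun θ t : ℝ => (t + θ) ^ p) (by fun_prop) _ _

/-- The square of the `L²` norm, over the central unit cell, of the derivative of `p`. -/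
noncomputable def gradEnergy (p : ℝ[X]) : ℝ :=
  ∫ w in (-(1 / 2) : ℝ)..(1 / 2), (derivative p).eval w ^ 2

theorem gradEnergy_C_add_smul (a b : ℝ) (p : ℝ[X]) :
    gradEnergy (C a + b • p) = b ^ 2 * gradEnergy p := by
  simp only [gradEnergy, derivative_add, derivative_C, zero_add, derivative_smul, eval_smul,
    smul_eq_mul, mul_pow, intervalIntegral.integral_const_mul]

theorem gradEnergy_pos {p : ℝ[X]} (hp : derivative p ≠ 0) : 0 < gradEnergy p := by
  have hcont : Continuous fun w => (derivative p).eval w ^ 2 := by fun_prop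
  refine intervalIntegral.integral_pos (by norm_num) hcont.continuousOn
    (fun _ _ => sq_nonneg _) ?_
  by_contra! hall
  refine hp (eq_zero_of_infinite_isRoot _ ((Set.Icc_infinite
    (show (-(1 / 2) : ℝ) < 1 / 2 by norm_num)).mono fun w hw => ?_))
  exact pow_eq_zero_iff two_ne_zero |>.1 (le_antisymm (hall w hw) (sq_nonneg _))

theorem derivative_reconPoly_sample_pow_ne_zero (κ : DataKind) (m : ℤ) {n p : ℕ} (hn : 3 ≤ n)
    (hp : 1 ≤ p) {a : ℝ} (ha : a ≠ 0) (θ : ℝ) :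
    derivative (reconPoly κ 0 1 m n
      (fun j => a * sample κ 1 (fun w => (w + θ) ^ p) j)) ≠ 0 := by
  intro h0
  have hC := eq_C_of_natDegree_eq_zero (derivative_eq_zero.1 h0)
  have hs : ∀ l < n, sample κ 1 (fun w => w ^ p) ((m + θ) + l)
      = a⁻¹ * (reconPoly κ 0 1 m n
        (fun j => a * sample κ 1 (fun w => (w + θ) ^ p) j)).coeff 0 := by
    intro l hl
    have := reconPoly_sample κ 0 one_pos m n
      (fun j => a * sample κ 1 (fun w => (w + θ) ^ p) j) hl
    rw [hC] at this
    simp only [eval_C, sample_const κ one_pos] at this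
    rw [this, inv_mul_cancel_left₀ ha, sample_add_const_pow]
    congr 1
    push_cast
    ring
  have h0 := hs 0 (by omega)
  have h1 := hs 1 (by omega)
  have h2 := hs 2 (by omega)
  push_cast at h0 h1 h2
  rw [add_zero] at h0
  exact not_sample_pow_const κ hp _ (h0.trans h1.symm) (h1.trans h2.symm)

/-- Compactness argument behind the lower bound of the smoothness indicators: the reconstructions of
the data of `a * (w + θ) ^ p`, for `θ` in a bounded set, and of small perturbations of these data,
have derivatives bounded away from zero. -/
theorem exists_pos_le_gradEnergy (κ : DataKind) (m : ℤ) {n p : ℕ} (hn : 3 ≤ n) (hp : 1 ≤ p)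
    {a : ℝ} (ha : a ≠ 0) (M : ℝ) :
    ∃ b δ : ℝ, 0 < b ∧ 0 < δ ∧ ∀ θ, |θ| ≤ M → ∀ F : ℤ → ℝ,
      (∀ l < n, |F (m + l) - a * sample κ 1 (fun w => (w + θ) ^ p) (m + l : ℤ)| < δ) →
      b ≤ gradEnergy (reconPoly κ 0 1 m n F) := by
  obtain ⟨E, hE⟩ : ∃ E : (Fin n → ℝ) → ℝ, E = fun v => ∫ w in (-(1 / 2) : ℝ)..(1 / 2),
      (∑ l : Fin n, v l * (derivative (reconPoly κ 0 1 m n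
        (Pi.single (m + (l : ℕ)) 1))).eval w) ^ 2 :=
    ⟨_, rfl⟩
  have hEcont : Continuous E := by
    rw [hE]
    exact intervalIntegral.continuous_parametric_intervalIntegral_of_continuous'
      (f := fun (v : Fin n → ℝ) w => (∑ l : Fin n, v l * (derivative (reconPoly κ 0 1 m n
        (Pi.single (m + (l : ℕ)) 1))).eval w) ^ 2) (by fun_prop) _ _
  have hEF : ∀ F : ℤ → ℝ, gradEnergy (reconPoly κ 0 1 m n F) = E fun l => F (m + (l : ℕ)) := by
    intro F
    rw [hE, gradEnergy, reconPoly_eq_sum, Finset.sum_range]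
    simp only [derivative_sum, derivative_smul, eval_finsetSum, eval_smul, smul_eq_mul]
  obtain ⟨V, hV⟩ : ∃ V : ℝ → Fin n → ℝ,
      V = fun θ (l : Fin n) => a * sample κ 1 (fun w => (w + θ) ^ p) (m + (l : ℕ) : ℤ) := ⟨_, rfl⟩
  have hVcont : Continuous V := by
    rw [hV]
    exact continuous_pi fun l => continuous_const.mul (continuous_sample_add_const_pow κ p _)
  have hK : IsCompact (V '' Set.Icc (-M) M) := isCompact_Icc.image hVcont
  have hpos : ∀ v ∈ V '' Set.Icc (-M) M, 0 < E v := by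
    rintro _ ⟨θ, -, rfl⟩
    have := gradEnergy_pos (derivative_reconPoly_sample_pow_ne_zero κ m hn hp ha θ)
    rw [hEF] at this
    rwa [hV]
  obtain ⟨b, hb, hbE⟩ := hK.exists_forall_le' hEcont.continuousOn hpos
  obtain ⟨δ, hδ, hsub⟩ := hK.exists_thickening_subset_open
    (isOpen_lt continuous_const hEcont)
    fun v hv => (half_lt_self hb).trans_le (hbE v hv)
  refine ⟨b / 2, δ, half_pos hb, hδ, fun θ hθ F hF => ?_⟩
  rw [hEF]
  refine (hsub (Metric.mem_thickening_iff.2 ⟨V θ, ⟨θ, abs_le.1 hθ, rfl⟩, ?_⟩)).le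
  rw [dist_pi_lt_iff hδ]
  intro l
  rw [Real.dist_eq, hV]
  exact hF l l.2

/-- The term `l = 1` of the smoothness indicator is scale invariant. -/
theorem gradEnergy_le_smoothInd (κ : DataKind) {r : ℕ} (hr : 2 ≤ r) (x₀ : ℝ) {h : ℝ} (hh : 0 < h)
    (F : ℤ → ℝ) (i : ℕ) :
    gradEnergy (reconPoly κ 0 1 (-(r : ℤ) + 1 + i) r F) ≤ smoothInd κ r x₀ h F i := by
  have hterm : ∀ l ∈ Finset.Icc 1 (r - 1), 0 ≤ ∫ x in (x₀ - h / 2)..(x₀ + h / 2),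
      h ^ (2 * l - 1) * ((derivative^[l] (subPoly κ r x₀ h F i)).eval x) ^ 2 := fun l _ =>
    intervalIntegral.integral_nonneg (by linarith) fun _ _ => by positivity
  refine le_of_eq_of_le ?_ (Finset.single_le_sum hterm (Finset.mem_Icc.2 ⟨le_rfl, by omega⟩ :
    1 ∈ Finset.Icc 1 (r - 1)))
  have hsub : ∀ g : ℝ → ℝ, ∫ x in (x₀ - h / 2)..(x₀ + h / 2), g x
      = h * ∫ w in (-(1 / 2) : ℝ)..(1 / 2), g (x₀ + h * w) := by
    intro g
    rw [intervalIntegral.integral_comp_add_mul _ hh.ne', smul_eq_mul, mul_inv_cancel_left₀ hh.ne']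
    congr 1 <;> ring
  rw [hsub, gradEnergy, ← reconPoly_comp κ x₀ hh, ← intervalIntegral.integral_const_mul]
  refine intervalIntegral.integral_congr fun w _ => ?_
  simp [derivative_comp, eval_comp, subPoly]
  ring

/-! ### The discriminant -/

/-- The discriminant of a perturbation of a multiple of a square is of first order in the
perturbation `E`, instead of the order zero that the size of the coefficients suggests. -/
theorem discrim_coeff_add_le {p E : ℝ[X]} {b θ β M e : ℝ} (hβ : |b| ≤ β) (hθ : |θ| ≤ M)
    (hp : p = C b * (X + C θ) ^ 2) (he : ∀ k, k ≤ 2 → |E.coeff k| ≤ e) :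
    |(p + E).coeff 1 ^ 2 - 4 * (p + E).coeff 2 * (p + E).coeff 0|
      ≤ 4 * β * (1 + M) ^ 2 * e + 5 * e ^ 2 := by
  have hpe : p = C b * X ^ 2 + C (2 * b * θ) * X + C (b * θ ^ 2) := by
    rw [hp]; simp only [map_mul, map_pow, map_ofNat]; ring
  have hquad : ∀ u v t : ℝ, (C u * X ^ 2 + C v * X + C t).coeff 0 = t
      ∧ (C u * X ^ 2 + C v * X + C t).coeff 1 = v ∧ (C u * X ^ 2 + C v * X + C t).coeff 2 = u :=
    fun u v t => ⟨by simp, by simp [coeff_C], by simp⟩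
  obtain ⟨c0, c1, c2⟩ := hpe ▸ hquad b (2 * b * θ) (b * θ ^ 2)
  rw [coeff_add, coeff_add, coeff_add, c0, c1, c2]
  have h0 := he 0 (by norm_num)
  have h1 := he 1 (by norm_num)
  have h2 := he 2 le_rfl
  generalize E.coeff 0 = e0 at *
  generalize E.coeff 1 = e1 at *
  generalize E.coeff 2 = e2 at *
  have hβ0 := (abs_nonneg b).trans hβ
  have hM0 := (abs_nonneg θ).trans hθ
  have he0 := (abs_nonneg e0).trans h0
  calc |(2 * b * θ + e1) ^ 2 - 4 * (b + e2) * (b * θ ^ 2 + e0)|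
      = |4 * (b * (θ * e1)) + e1 ^ 2 + -(4 * (b * e0)) + -(4 * (b * (θ ^ 2 * e2)))
        + -(4 * (e2 * e0))| := by ring_nf
    _ ≤ 4 * (|b| * (|θ| * |e1|)) + |e1| ^ 2 + 4 * (|b| * |e0|) + 4 * (|b| * (|θ| ^ 2 * |e2|))
        + 4 * (|e2| * |e0|) := by
      refine (abs_add_le _ _).trans (add_le_add ((abs_add_le _ _).trans (add_le_add
        ((abs_add_le _ _).trans (add_le_add ((abs_add_le _ _).trans
          (add_le_add ?_ ?_)) ?_)) ?_)) ?_)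
      all_goals simp [abs_mul]
    _ ≤ 4 * (β * (M * e)) + e ^ 2 + 4 * (β * e) + 4 * (β * (M ^ 2 * e)) + 4 * (e * e) := by
      gcongr
    _ ≤ _ := by
      have : 0 ≤ β * (M * e) := by positivity
      nlinarith

/-! ### The nonlinear weights -/

theorem one_add_rpow_le {x s : ℝ} (hx0 : 0 ≤ x) (hx1 : x ≤ 1) (hs : 0 < s) :
    (1 + x) ^ s ≤ 1 + s * Real.exp s * x := by
  have h1 : (1 + x) ^ s ≤ Real.exp (s * x) := by
    rw [mul_comm, Real.exp_mul]
    exact Real.rpow_le_rpow (by linarith) (by linarith [Real.add_one_le_exp x]) hs.le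
  have h2 : Real.exp (s * x) ≤ 1 + s * x * Real.exp (s * x) := by
    have h3 := Real.add_one_le_exp (-(s * x))
    have h4 := mul_le_mul_of_nonneg_right h3 (Real.exp_pos (s * x)).le
    rw [← Real.exp_add, neg_add_cancel, Real.exp_zero] at h4
    linarith
  have h5 : Real.exp (s * x) ≤ Real.exp s := Real.exp_le_exp.2 (by nlinarith)
  calc (1 + x) ^ s ≤ 1 + s * x * Real.exp (s * x) := h1.trans h2
    _ ≤ 1 + s * x * Real.exp s := by gcongr
    _ = _ := by ring

/-- If the weights `α i` exceed weights `c i` of sum one by a factor between `1` and `1 + η`, then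
normalizing them brings them back to within `η` of the `c i`. -/
theorem abs_normalized_sub_le {r : ℕ} {c α : ℕ → ℝ} (hc : ∀ i < r, 0 < c i)
    (hsum : ∑ i ∈ Finset.range r, c i = 1) {η : ℝ}
    (hα : ∀ i < r, c i ≤ α i) (hα' : ∀ i < r, α i ≤ c i * (1 + η)) {i : ℕ} (hi : i < r) :
    |α i / ∑ j ∈ Finset.range r, α j - c i| ≤ min 1 η := by
  obtain ⟨S, hS⟩ : ∃ S, S = ∑ j ∈ Finset.range r, α j := ⟨_, rfl⟩
  rw [← hS]
  have hS1 : 1 ≤ S := by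
    rw [← hsum, hS]; exact Finset.sum_le_sum fun j hj => hα j (Finset.mem_range.1 hj)
  have hS2 : S ≤ 1 + η := by
    calc S ≤ ∑ j ∈ Finset.range r, c j * (1 + η) := by
          rw [hS]; exact Finset.sum_le_sum fun j hj => hα' j (Finset.mem_range.1 hj)
      _ = 1 + η := by rw [← Finset.sum_mul, hsum, one_mul]
  have hSpos : 0 < S := by linarith
  have hci : c i ≤ 1 := by
    rw [← hsum]
    exact Finset.single_le_sum (fun j hj => (hc j (Finset.mem_range.1 hj)).le)
      (Finset.mem_range.2 hi)
  have hαS : α i ≤ S := by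
    rw [hS]
    exact Finset.single_le_sum (fun j hj => ((hc j (Finset.mem_range.1 hj)).trans_le
      (hα j (Finset.mem_range.1 hj))).le) (Finset.mem_range.2 hi)
  have hi0 := hc i hi
  have hi1 := hα i hi
  have hi2 := hα' i hi
  refine le_min ?_ ?_
  · have h1 : α i / S ≤ 1 := (div_le_one hSpos).2 hαS
    have h2 : 0 ≤ α i / S := div_nonneg (by linarith) hSpos.le
    exact abs_le.2 ⟨by linarith, by linarith⟩
  · have hη : 0 ≤ η := by linarith
    rw [div_sub' hSpos.ne', abs_div, abs_of_pos hSpos, div_le_iff₀ hSpos]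
    have : c i * (S - 1) ≤ η := by nlinarith
    have : c i * η ≤ η := by nlinarith
    have : 0 ≤ c i * (S - 1) := mul_nonneg hi0.le (by linarith)
    have : η ≤ η * S := by nlinarith
    exact abs_le.2 ⟨by nlinarith, by nlinarith⟩

theorem dOne_nonneg (r : ℕ) (F : ℤ → ℝ) : 0 ≤ dOne r F := sq_nonneg _

theorem smoothInd_nonneg (κ : DataKind) (r : ℕ) (x₀ : ℝ) {h : ℝ} (hh : 0 < h) (F : ℤ → ℝ) (i : ℕ) :
    0 ≤ smoothInd κ r x₀ h F i :=
  Finset.sum_nonneg fun _ _ => intervalIntegral.integral_nonneg (by linarith) fun _ _ => by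
    positivity

theorem dTerm_nonneg (κ : DataKind) (r : ℕ) (s₁ : ℝ) {ε : ℝ} (hε : 0 < ε) (x₀ h : ℝ) (F : ℤ → ℝ) :
    0 ≤ dTerm κ r s₁ ε x₀ h F := by
  have := dOne_nonneg r F
  unfold dTerm
  positivity

theorem dTerm_le_min (κ : DataKind) (r : ℕ) (s₁ : ℝ) {ε : ℝ} (hε : 0 < ε) (x₀ h : ℝ)
    (F : ℤ → ℝ) :
    dTerm κ r s₁ ε x₀ h F ≤ min (dOne r F) |dTwo κ r x₀ h F| ^ s₁ := by
  have h1 := Real.rpow_nonneg (dOne_nonneg r F) s₁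
  have h2 := Real.rpow_nonneg (abs_nonneg (dTwo κ r x₀ h F)) s₁
  have h3 : 0 < dOne r F ^ s₁ + |dTwo κ r x₀ h F| ^ s₁ + ε := by positivity
  unfold dTerm
  rw [div_le_iff₀ h3]
  rcases min_choice (dOne r F) |dTwo κ r x₀ h F| with hm | hm <;> rw [hm] <;> nlinarith

theorem ideal_le_alphaWeight (κ : DataKind) {r : ℕ} {c : ℕ → ℝ} (hc : IsIdealWeights κ r c)
    (s₁ : ℝ) {s₂ ε : ℝ} (hs₂ : 0 < s₂) (hε : 0 < ε) (x₀ : ℝ) {h : ℝ} (hh : 0 < h)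
    (F : ℤ → ℝ) {i : ℕ} (hi : i < r) : c i ≤ alphaWeight κ r c s₁ s₂ ε x₀ h F i := by
  have hd := dTerm_nonneg κ r s₁ hε x₀ h F
  have hx0 : 0 ≤ dTerm κ r s₁ ε x₀ h F / (smoothInd κ r x₀ h F i ^ s₁ + ε) := by
    have := smoothInd_nonneg κ r x₀ hh F i
    positivity
  exact le_mul_of_one_le_right (hc.pos i hi).le (Real.one_le_rpow (by linarith) hs₂.le)

/-- The relative size of the smoothness detector controls the distance of the nonlinear weights to
the ideal ones. -/
theorem abs_omegaWeight_sub_le (κ : DataKind) {r : ℕ} {c : ℕ → ℝ} (hc : IsIdealWeights κ r c)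
    {s₁ s₂ ε : ℝ} (hs₁ : 1 ≤ s₁) (hs₂ : 0 < s₂) (hε : 0 < ε) (x₀ : ℝ) {h : ℝ} (hh : 0 < h)
    (F : ℤ → ℝ) {D : ℝ} (hD0 : 0 ≤ D) (hD : D ≤ 1) (hI0 : ∀ i < r, 0 < smoothInd κ r x₀ h F i)
    (hI : ∀ i < r, min (dOne r F) |dTwo κ r x₀ h F| ≤ D * smoothInd κ r x₀ h F i)
    {i : ℕ} (hi : i < r) :
    |omegaWeight κ r c s₁ s₂ ε x₀ h F i - c i| ≤ s₂ * Real.exp s₂ * D := by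
  have hd := dTerm_nonneg κ r s₁ hε x₀ h F
  have hx0 : ∀ j < r, 0 ≤ dTerm κ r s₁ ε x₀ h F / (smoothInd κ r x₀ h F j ^ s₁ + ε) :=
    fun j hj => by have := hI0 j hj; positivity
  have hx : ∀ j < r, dTerm κ r s₁ ε x₀ h F / (smoothInd κ r x₀ h F j ^ s₁ + ε) ≤ D := by
    intro j hj
    have hIj := hI0 j hj
    have hpos : 0 < smoothInd κ r x₀ h F j ^ s₁ := by positivity
    rw [div_le_iff₀ (by positivity)]
    calc dTerm κ r s₁ ε x₀ h F ≤ min (dOne r F) |dTwo κ r x₀ h F| ^ s₁ :=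
          dTerm_le_min κ r s₁ hε x₀ h F
      _ ≤ (D * smoothInd κ r x₀ h F j) ^ s₁ := Real.rpow_le_rpow
          (le_min (dOne_nonneg r F) (abs_nonneg _)) (hI j hj) (by linarith)
      _ = D ^ s₁ * smoothInd κ r x₀ h F j ^ s₁ := Real.mul_rpow hD0 hIj.le
      _ ≤ D * smoothInd κ r x₀ h F j ^ s₁ := by
          gcongr
          simpa using Real.rpow_le_rpow_of_exponent_ge' hD0 hD zero_le_one hs₁
      _ ≤ D * (smoothInd κ r x₀ h F j ^ s₁ + ε) := by gcongr; linarith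
  refine (abs_normalized_sub_le hc.pos hc.sum_eq_one (α := alphaWeight κ r c s₁ s₂ ε x₀ h F)
    (fun j hj => ideal_le_alphaWeight κ hc s₁ hs₂ hε x₀ hh F hj) (fun j hj => ?_) hi).trans
    (min_le_right _ _)
  refine mul_le_mul_of_nonneg_left ?_ (hc.pos j hj).le
  refine (one_add_rpow_le (hx0 j hj) ((hx j hj).trans hD) hs₂).trans ?_
  gcongr
  exact hx j hj

theorem abs_omegaWeight_sub_le_one (κ : DataKind) {r : ℕ} {c : ℕ → ℝ} (hc : IsIdealWeights κ r c)
    {s₁ s₂ ε : ℝ} (hs₂ : 0 < s₂) (hε : 0 < ε) (x₀ : ℝ) {h : ℝ} (hh : 0 < h)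
    (F : ℤ → ℝ) {i : ℕ} (hi : i < r) :
    |omegaWeight κ r c s₁ s₂ ε x₀ h F i - c i| ≤ 1 := by
  have h1 : ∀ j < r, c j ≤ alphaWeight κ r c s₁ s₂ ε x₀ h F j := fun j hj =>
    ideal_le_alphaWeight κ hc s₁ hs₂ hε x₀ hh F hj
  -- any upper bound of the ratios `α j / c j` serves, since only the bound by `1` is used
  refine (abs_normalized_sub_le hc.pos hc.sum_eq_one h1
    (η := ∑ j ∈ Finset.range r, alphaWeight κ r c s₁ s₂ ε x₀ h F j / c j) (fun j hj => ?_) hi).trans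
    (min_le_left _ _)
  have h2 : alphaWeight κ r c s₁ s₂ ε x₀ h F j / c j
      ≤ ∑ j ∈ Finset.range r, alphaWeight κ r c s₁ s₂ ε x₀ h F j / c j :=
    Finset.single_le_sum (f := fun j => alphaWeight κ r c s₁ s₂ ε x₀ h F j / c j)
      (fun k hk => div_nonneg ((hc.pos k (Finset.mem_range.1 hk)).le.trans
        (h1 k (Finset.mem_range.1 hk))) (hc.pos k (Finset.mem_range.1 hk)).le)
      (Finset.mem_range.2 hj)
  rw [div_le_iff₀ (hc.pos j hj)] at h2
  nlinarith [hc.pos j hj]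

/-! ### Error of the reconstructions -/

theorem exists_abs_apply_reconPoly_sub_le (κ : DataKind) (m : ℤ) (n : ℕ) (φ : ℝ[X] →ₗ[ℝ] ℝ) :
    ∃ K : ℝ, 0 ≤ K ∧ ∀ (F : ℤ → ℝ) (q : ℝ[X]) (B : ℝ), q.degree < n →
      (∀ l < n, |F (m + l) - sample κ 1 (fun w => q.eval w) (m + l : ℤ)| ≤ B) →
      |φ (reconPoly κ 0 1 m n F - q)| ≤ K * B := by
  obtain ⟨K, hK, hKF⟩ := exists_abs_apply_reconPoly_le κ m n φ
  refine ⟨K, hK, fun F q B hq hF => ?_⟩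
  have := hKF (fun j => F j - sample κ 1 (fun w => q.eval w) j) B hF
  rwa [reconPoly_sub, reconPoly_sample_eval κ m n hq] at this

theorem recon_sub_fullPoly_eval (κ : DataKind) {r : ℕ} {c : ℕ → ℝ} (hc : IsIdealWeights κ r c)
    (s₁ : ℝ) {s₂ ε : ℝ} (hs₂ : 0 < s₂) (hε : 0 < ε) (x₀ : ℝ) {h : ℝ} (hh : 0 < h)
    (F : ℤ → ℝ) (b : ℝ) :
    recon κ r c s₁ s₂ ε x₀ h F - (fullPoly κ r x₀ h F).eval (x₀ + h / 2)
      = ∑ i ∈ Finset.range r, (omegaWeight κ r c s₁ s₂ ε x₀ h F i - c i)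
        * ((subPoly κ r x₀ h F i).eval (x₀ + h / 2) - b) := by
  have hS : 1 ≤ ∑ j ∈ Finset.range r, alphaWeight κ r c s₁ s₂ ε x₀ h F j := by
    rw [← hc.sum_eq_one]
    exact Finset.sum_le_sum fun j hj =>
      ideal_le_alphaWeight κ hc s₁ hs₂ hε x₀ hh F (Finset.mem_range.1 hj)
  have hω : ∑ i ∈ Finset.range r, omegaWeight κ r c s₁ s₂ ε x₀ h F i = 1 := by
    simp only [omegaWeight]
    rw [← Finset.sum_div, div_self (by linarith)]
  rw [← hc.ideal x₀ h hh F, recon]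
  simp only [sub_mul, mul_sub, Finset.sum_sub_distrib, ← Finset.sum_mul, hω, hc.sum_eq_one]
  ring

/-- `∑ a t * (x - z) ^ t` is a Taylor expansion of `f` at `z` up to the order `N`, and `f` is
continuous near `z`. -/
def HasTaylorExpansion (f : ℝ → ℝ) (z : ℝ) (a : ℕ → ℝ) (N : ℕ) : Prop :=
  (∀ᶠ x in nhds z, ContinuousAt f x) ∧
    ∀ k ≤ N, (fun x => f x - ∑ t ∈ Finset.range k, a t * (x - z) ^ t)
      =O[nhds z] fun x => (x - z) ^ k

theorem exists_hasTaylorExpansion {f : ℝ → ℝ} {z : ℝ} {N : ℕ} (hf : ContDiffAt ℝ N f z) :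
    ∃ a, HasTaylorExpansion f z a N := by
  obtain ⟨a, ha⟩ := exists_taylor_isBigO hf
  exact ⟨a, (hf.eventually (by simp)).mono fun x hx => hx.continuousAt, ha⟩

theorem HasTaylorExpansion.exists_abs_gridData_sub_le {f : ℝ → ℝ} {z : ℝ} {a : ℕ → ℝ} {N : ℕ}
    (hf : HasTaylorExpansion f z a N) (κ : DataKind) (r : ℕ) {k : ℕ} (hk : k ≤ N) (M : ℝ) :
    ∃ K : ℝ, 0 ≤ K ∧ ∀ᶠ h in nhdsWithin (0 : ℝ) (Set.Ioi 0), ∀ x₀, |x₀ - z| ≤ M * h →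
      ∀ j : ℤ, -(r : ℤ) ≤ j → j ≤ r → |gridData κ f x₀ h j
        - sample κ 1 (fun w => (scaledTaylor a k h ((x₀ - z) / h)).eval w) j| ≤ K * h ^ k := by
  obtain ⟨K, hK, hKh⟩ := exists_abs_sample_sub_scaledTaylor_le κ hf.1 (hf.2 k hk) M r
  refine ⟨K, hK, hKh.mono fun h hh x₀ hx₀ j hj1 hj2 => hh x₀ hx₀ j (abs_le.2 ⟨?_, ?_⟩)⟩
  · exact_mod_cast hj1
  · exact_mod_cast hj2

theorem HasTaylorExpansion.exists_abs_sub_fullPoly_le {f : ℝ → ℝ} {z : ℝ} {a : ℕ → ℝ} {r : ℕ}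
    (hf : HasTaylorExpansion f z a (2 * r - 1)) (κ : DataKind) (M : ℝ) :
    ∃ K : ℝ, 0 ≤ K ∧ ∀ᶠ h in nhdsWithin (0 : ℝ) (Set.Ioi 0), ∀ x₀, |x₀ - z| ≤ M * h →
      |f (x₀ + h / 2) - (fullPoly κ r x₀ h (gridData κ f x₀ h)).eval (x₀ + h / 2)|
        ≤ K * h ^ (2 * r - 1) := by
  obtain ⟨K₁, hK₁, h₁⟩ := exists_abs_sample_sub_scaledTaylor_le .pointValues hf.1 (hf.2 _ le_rfl)
    M (1 / 2)
  obtain ⟨K₂, hK₂, h₂⟩ := hf.exists_abs_gridData_sub_le κ r le_rfl M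
  obtain ⟨K₃, hK₃, h₃⟩ := exists_abs_apply_reconPoly_sub_le κ (-(r : ℤ) + 1) (2 * r - 1)
    (leval (1 / 2))
  refine ⟨K₁ + K₃ * K₂, by positivity, ?_⟩
  filter_upwards [h₁, h₂, self_mem_nhdsWithin] with h h₁ h₂ hh x₀ hx₀
  have e₁ := h₁ x₀ hx₀ (1 / 2) (by norm_num)
  have e₃ := h₃ (gridData κ f x₀ h) _ _ (scaledTaylor_degree_lt a _ h ((x₀ - z) / h))
    fun l hl => h₂ x₀ hx₀ _ (by omega) (by omega)
  simp only [sample] at e₁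
  rw [show x₀ + 1 / 2 * h = x₀ + h / 2 by ring] at e₁
  simp only [leval_apply, eval_sub] at e₃
  rw [fullPoly, eval_reconPoly_midpoint κ x₀ hh]
  rw [abs_le] at *
  constructor <;> nlinarith

theorem HasTaylorExpansion.exists_abs_subPoly_sub_le {f : ℝ → ℝ} {z : ℝ} {a : ℕ → ℝ} {N m r : ℕ}
    (hf : HasTaylorExpansion f z a N) (κ : DataKind) (hm : 1 ≤ m) (hmN : m ≤ N)
    (ha : ∀ t, 1 ≤ t → t < m → a t = 0) (M : ℝ) :
    ∃ K : ℝ, 0 ≤ K ∧ ∀ᶠ h in nhdsWithin (0 : ℝ) (Set.Ioi 0), ∀ x₀, |x₀ - z| ≤ M * h →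
      ∀ i < r, |(subPoly κ r x₀ h (gridData κ f x₀ h) i).eval (x₀ + h / 2) - a 0|
        ≤ K * h ^ m := by
  obtain ⟨K₂, hK₂, h₂⟩ := hf.exists_abs_gridData_sub_le κ r hmN M
  choose K₃ hK₃ h₃ using fun i : ℕ => exists_abs_apply_reconPoly_sub_le κ (-(r : ℤ) + 1 + i) r
    (leval (1 / 2))
  refine ⟨(∑ i ∈ Finset.range r, K₃ i) * K₂,
    mul_nonneg (Finset.sum_nonneg fun i _ => hK₃ i) hK₂, ?_⟩
  filter_upwards [h₂, self_mem_nhdsWithin] with h h₂ hh x₀ hx₀ i hi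
  have hh' : (0 : ℝ) < h := hh
  have e₃ := h₃ i (gridData κ f x₀ h) (C (a 0)) (K₂ * h ^ m)
    (degree_C_le.trans_lt (by exact_mod_cast (by omega : 0 < r))) fun l hl => by
      have := h₂ x₀ hx₀ (-(r : ℤ) + 1 + i + l) (by omega) (by omega)
      rwa [scaledTaylor_eq_C a hm ha] at this
  simp only [leval_apply, eval_sub, eval_C] at e₃
  rw [subPoly, eval_reconPoly_midpoint κ x₀ hh]
  refine e₃.trans ?_
  rw [mul_assoc]
  gcongr
  exact Finset.single_le_sum (fun i _ => hK₃ i) (Finset.mem_range.2 hi)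

/-! ### Orders of `I i`, `d₁` and `d₂` in `h` -/

/-- If `a m` is the first nonzero Taylor coefficient after `a 0`, no smoothness indicator is
smaller than the order `h ^ (2 * m)`. -/
theorem HasTaylorExpansion.exists_pow_le_smoothInd {f : ℝ → ℝ} {z : ℝ} {a : ℕ → ℝ} {N m r : ℕ}
    (hf : HasTaylorExpansion f z a N) (κ : DataKind) (hr : 3 ≤ r) (hm : 1 ≤ m) (hmN : m + 1 ≤ N)
    (ha : ∀ t, 1 ≤ t → t < m → a t = 0) (ham : a m ≠ 0) (M : ℝ) :
    ∃ K : ℝ, 0 ≤ K ∧ ∀ᶠ h in nhdsWithin (0 : ℝ) (Set.Ioi 0), ∀ x₀, |x₀ - z| ≤ M * h →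
      ∀ i < r, h ^ (2 * m) ≤ K * smoothInd κ r x₀ h (gridData κ f x₀ h) i := by
  obtain ⟨K₂, hK₂, h₂⟩ := hf.exists_abs_gridData_sub_le κ r hmN M
  choose b δ hb hδ hbδ using fun i : ℕ =>
    exists_pos_le_gradEnergy κ (-(r : ℤ) + 1 + i) hr hm ham M
  refine ⟨∑ i ∈ Finset.range r, (b i)⁻¹, Finset.sum_nonneg fun i _ => (inv_pos.2 (hb i)).le, ?_⟩
  have hsmall : ∀ᶠ h in nhdsWithin (0 : ℝ) (Set.Ioi 0), ∀ i ∈ Finset.range r, K₂ * h < δ i := by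
    refine (Finset.eventually_all _).2 fun i _ => nhdsWithin_le_nhds ?_
    have : Filter.Tendsto (fun h : ℝ => K₂ * h) (nhds 0) (nhds 0) := by
      simpa using (continuous_const_mul K₂).tendsto 0
    exact this.eventually_lt_const (hδ i)
  filter_upwards [h₂, hsmall, self_mem_nhdsWithin] with h h₂ hsmall hh x₀ hx₀ i hi
  have hh' : (0 : ℝ) < h := hh
  have hhm : (0 : ℝ) < h ^ m := by positivity
  set F := gridData κ f x₀ h with hF
  set θ := (x₀ - z) / h with hθ
  have hθM : |θ| ≤ M := by
    rw [hθ, abs_div, abs_of_pos hh', div_le_iff₀ hh']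
    exact hx₀
  -- `G` is close to the data of `a m * (w + θ) ^ m`
  obtain ⟨G, hG⟩ : ∃ G : ℤ → ℝ, G = fun j => (h ^ m)⁻¹ * (F j - a 0) := ⟨_, rfl⟩
  have hrec : reconPoly κ 0 1 (-(r : ℤ) + 1 + i) r F
      = C (a 0) + h ^ m • reconPoly κ 0 1 (-(r : ℤ) + 1 + i) r G := by
    have h0 : reconPoly κ 0 1 (-(r : ℤ) + 1 + i) r (fun _ => a 0) = C (a 0) := by
      have := reconPoly_sample_eval κ (-(r : ℤ) + 1 + i) r (q := C (a 0))
        (degree_C_le.trans_lt (by exact_mod_cast (by omega : 0 < r)))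
      simpa only [eval_C, sample_const κ one_pos] using this
    rw [hG, reconPoly_const_mul, reconPoly_sub, h0, smul_smul, mul_inv_cancel₀ hhm.ne', one_smul]
    ring
  have hGb : b i ≤ gradEnergy (reconPoly κ 0 1 (-(r : ℤ) + 1 + i) r G) := by
    refine hbδ i θ hθM G fun l hl => ?_
    refine lt_of_le_of_lt ?_ (hsmall i (Finset.mem_range.2 hi))
    have e := h₂ x₀ hx₀ (-(r : ℤ) + 1 + i + l) (by omega) (by omega)
    rw [scaledTaylor_eq_add a hm (Nat.lt_succ_self m) fun t h1 h2 h3 => ha t h1 (by omega)] at e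
    simp only [eval_add, eval_mul, eval_C, eval_pow, eval_X] at e
    rw [sample_add κ 1 (by fun_prop) (by fun_prop), sample_const κ one_pos,
      sample_const_mul, ← hθ, ← hF] at e
    rw [hG]
    refine le_of_mul_le_mul_left ?_ hhm
    rw [← abs_of_pos hhm, ← abs_mul, abs_of_pos hhm]
    refine le_of_eq_of_le ?_ (e.trans_eq (by ring))
    congr 1
    field_simp
    ring
  calc h ^ (2 * m) = (b i)⁻¹ * (b i * (h ^ m) ^ 2) := by
        rw [inv_mul_cancel_left₀ (hb i).ne', ← pow_mul, mul_comm m 2]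
    _ ≤ (b i)⁻¹ * smoothInd κ r x₀ h F i := by
        refine mul_le_mul_of_nonneg_left ?_ (inv_pos.2 (hb i)).le
        refine le_trans ?_ (gradEnergy_le_smoothInd κ (by omega) x₀ hh' F i)
        rw [hrec, gradEnergy_C_add_smul, mul_comm]
        gcongr
    _ ≤ _ := by
        refine mul_le_mul_of_nonneg_right ?_ (smoothInd_nonneg κ r x₀ hh' F i)
        exact Finset.single_le_sum (f := fun i => (b i)⁻¹) (fun i _ => (inv_pos.2 (hb i)).le)
          (Finset.mem_range.2 hi)

theorem HasTaylorExpansion.exists_dOne_le {f : ℝ → ℝ} {z : ℝ} {a : ℕ → ℝ} {N r : ℕ}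
    (hf : HasTaylorExpansion f z a N) (κ : DataKind) (hr : 1 ≤ r) (hN : 2 * r - 2 ≤ N) (M : ℝ) :
    ∃ K : ℝ, 0 ≤ K ∧ ∀ᶠ h in nhdsWithin (0 : ℝ) (Set.Ioi 0), ∀ x₀, |x₀ - z| ≤ M * h →
      dOne r (gridData κ f x₀ h) ≤ K * h ^ (2 * (2 * r - 2)) := by
  obtain ⟨K, hK, hKh⟩ := hf.exists_abs_gridData_sub_le κ r hN M
  refine ⟨(2 ^ (2 * r - 2) * K) ^ 2, by positivity, hKh.mono fun h hh x₀ hx₀ => ?_⟩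
  refine (dOne_le κ hr (scaledTaylor_degree_lt a _ h ((x₀ - z) / h)) fun j hj =>
    hh x₀ hx₀ _ (by omega) (by omega)).trans_eq ?_
  rw [← mul_assoc, mul_pow, ← pow_mul, mul_comm 2 (2 * r - 2)]

/-- If the Taylor polynomial of degree `2 * r - 2` is constant up to its leading term, its
derivative of order `2 * r - 4` is a multiple of a square and has discriminant zero, and `d₂`
gains one order in `h`. -/
theorem HasTaylorExpansion.exists_abs_dTwo_le {f : ℝ → ℝ} {z : ℝ} {a : ℕ → ℝ} {r : ℕ}
    (hf : HasTaylorExpansion f z a (2 * r - 1)) (κ : DataKind) (hr : 3 ≤ r)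
    (ha : ∀ t, 1 ≤ t → t < 2 * r - 2 → a t = 0) (M : ℝ) :
    ∃ K : ℝ, 0 ≤ K ∧ ∀ᶠ h in nhdsWithin (0 : ℝ) (Set.Ioi 0), ∀ x₀, |x₀ - z| ≤ M * h →
      |dTwo κ r x₀ h (gridData κ f x₀ h)| ≤ K * h ^ (1 + 2 * (2 * r - 2)) := by
  obtain ⟨K₂, hK₂, h₂⟩ := hf.exists_abs_gridData_sub_le κ r le_rfl M
  choose K₃ hK₃ h₃ using fun k : ℕ => exists_abs_apply_reconPoly_sub_le κ (-(r : ℤ) + 1)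
    (2 * r - 1) ((lcoeff ℝ k).comp (derivative ^ (2 * r - 4)))
  set c₀ : ℝ := ((2 * r - 2).descFactorial (2 * r - 4) : ℝ) with hc₀
  set γ : ℝ := (∑ k ∈ Finset.range 3, K₃ k) * K₂ with hγ
  have hγ0 : 0 ≤ γ := mul_nonneg (Finset.sum_nonneg fun k _ => hK₃ k) hK₂
  set β : ℝ := |a (2 * r - 2)| * c₀ with hβ
  refine ⟨4 * β * (1 + |M|) ^ 2 * γ + 5 * γ ^ 2, by positivity, ?_⟩
  filter_upwards [h₂, Ioo_mem_nhdsGT one_pos] with h h₂ ⟨hh, hh1⟩ x₀ hx₀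
  set F := gridData κ f x₀ h with hF
  set θ := (x₀ - z) / h with hθ
  have hθM : |θ| ≤ |M| := by
    rw [hθ, abs_div, abs_of_pos hh, div_le_iff₀ hh]
    exact hx₀.trans (by gcongr; exact le_abs_self M)
  set q := scaledTaylor a (2 * r - 1) h θ with hq
  set E := derivative^[2 * r - 4] (reconPoly κ 0 1 (-(r : ℤ) + 1) (2 * r - 1) F - q) with hE
  have hpar : parabola κ r x₀ h F = derivative^[2 * r - 4] q + E := by
    rw [parabola, fullPoly, reconPoly_comp κ x₀ hh, hE, ← iterate_map_add derivative,
      add_sub_cancel]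
  have hder : derivative^[2 * r - 4] q
      = C (a (2 * r - 2) * h ^ (2 * r - 2) * c₀) * (X + C θ) ^ 2 := by
    rw [hq, scaledTaylor_eq_add a (m := 2 * r - 2) (by omega) (by omega)
      fun t h1 h2 h3 => ha t h1 (by omega), iterate_map_add derivative,
      iterate_derivative_C (by omega),
      zero_add, iterate_derivative_C_mul, iterate_derivative_X_add_pow,
      show 2 * r - 2 - (2 * r - 4) = 2 by omega, hc₀]
    simp only [map_mul, map_natCast, nsmul_eq_mul]
    ring
  have hEk : ∀ k, k ≤ 2 → |E.coeff k| ≤ γ * h ^ (2 * r - 1) := by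
    intro k hk
    have := h₃ k F q _ (scaledTaylor_degree_lt a _ h θ) fun l hl =>
      h₂ x₀ hx₀ _ (by omega) (by omega)
    rw [LinearMap.comp_apply, Module.End.pow_apply, lcoeff_apply] at this
    refine this.trans ?_
    rw [hγ, mul_assoc]
    gcongr
    exact Finset.single_le_sum (fun k _ => hK₃ k) (Finset.mem_range.2 (by omega))
  have hb : |a (2 * r - 2) * h ^ (2 * r - 2) * c₀| ≤ β * h ^ (2 * r - 2) := by
    rw [abs_mul, abs_mul, abs_of_pos (pow_pos hh _),
      abs_of_nonneg (a := c₀) (Nat.cast_nonneg _), hβ]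
    exact le_of_eq (by ring)
  have hpow : h ^ (2 * r - 1) = h ^ (2 * r - 2) * h := by
    rw [← pow_succ]; congr 1; omega
  have := discrim_coeff_add_le hb hθM hder hEk
  rw [dTwo, hpar]
  refine this.trans ?_
  rw [hpow, pow_add, pow_one, mul_comm 2 (2 * r - 2), pow_mul]
  set H := h ^ (2 * r - 2)
  have : 5 * γ ^ 2 * (h * h) * H ^ 2 ≤ 5 * γ ^ 2 * (h * 1) * H ^ 2 := by gcongr
  linarith

/-- The numerator of the weights is smaller than the smoothness indicators, of order `h ^ (2 * m)`,
by a factor `h ^ e`, where `e` makes up for the order `m` of the substencil errors. -/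
theorem HasTaylorExpansion.exists_min_le {f : ℝ → ℝ} {z : ℝ} {a : ℕ → ℝ} {r m : ℕ}
    (hf : HasTaylorExpansion f z a (2 * r - 1)) (κ : DataKind) (hr : 3 ≤ r) (hmr : m ≤ 2 * r - 2)
    (ha : ∀ t, 1 ≤ t → t < m → a t = 0) (M : ℝ) :
    ∃ e : ℕ, 1 ≤ e ∧ 2 * r - 1 ≤ e + m ∧ ∃ K : ℝ, 0 ≤ K ∧
      ∀ᶠ h in nhdsWithin (0 : ℝ) (Set.Ioi 0), ∀ x₀, |x₀ - z| ≤ M * h →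
        min (dOne r (gridData κ f x₀ h)) |dTwo κ r x₀ h (gridData κ f x₀ h)|
          ≤ K * h ^ (e + 2 * m) := by
  rcases hmr.lt_or_eq with hlt | rfl
  · obtain ⟨K, hK, hKh⟩ := hf.exists_dOne_le (r := r) κ (by omega) (by omega) M
    refine ⟨2 * (2 * r - 2) - 2 * m, by omega, by omega, K, hK, hKh.mono fun h hh x₀ hx₀ => ?_⟩
    rw [Nat.sub_add_cancel (by omega)]
    exact (min_le_left _ _).trans (hh x₀ hx₀)
  · obtain ⟨K, hK, hKh⟩ := hf.exists_abs_dTwo_le κ hr ha M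
    exact ⟨1, le_rfl, by omega, K, hK, hKh.mono fun h hh x₀ hx₀ =>
      (min_le_right _ _).trans (hh x₀ hx₀)⟩

/-! ### Distance to the reconstruction of the whole stencil -/

theorem abs_recon_sub_fullPoly_le (κ : DataKind) {r : ℕ} {c : ℕ → ℝ} (hc : IsIdealWeights κ r c)
    (s₁ : ℝ) {s₂ ε : ℝ} (hs₂ : 0 < s₂) (hε : 0 < ε) (x₀ : ℝ) {h : ℝ} (hh : 0 < h)
    (F : ℤ → ℝ) {b A B : ℝ}
    (hA : ∀ i < r, |omegaWeight κ r c s₁ s₂ ε x₀ h F i - c i| ≤ A)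
    (hB : ∀ i < r, |(subPoly κ r x₀ h F i).eval (x₀ + h / 2) - b| ≤ B) :
    |recon κ r c s₁ s₂ ε x₀ h F - (fullPoly κ r x₀ h F).eval (x₀ + h / 2)| ≤ r * (A * B) := by
  rw [recon_sub_fullPoly_eval κ hc s₁ hs₂ hε x₀ hh F b]
  refine (Finset.abs_sum_le_sum_abs _ _).trans ?_
  refine (Finset.sum_le_card_nsmul _ _ (A * B) fun i hi => ?_).trans_eq (by simp)
  have hi' := Finset.mem_range.1 hi
  rw [abs_mul]
  exact mul_le_mul (hA i hi') (hB i hi') (abs_nonneg _) ((abs_nonneg _).trans (hA i hi'))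

theorem HasTaylorExpansion.exists_abs_recon_sub_fullPoly_le {f : ℝ → ℝ} {z : ℝ} {a : ℕ → ℝ} {r : ℕ}
    (hf : HasTaylorExpansion f z a (2 * r - 1)) (κ : DataKind) (hr : 3 ≤ r) {s₁ s₂ : ℝ}
    (hs₁ : 1 ≤ s₁) (hs₂ : 0 < s₂) {c : ℕ → ℝ} (hc : IsIdealWeights κ r c) (M : ℝ) :
    ∃ K : ℝ, 0 ≤ K ∧ ∀ᶠ h in nhdsWithin (0 : ℝ) (Set.Ioi 0), ∀ x₀, |x₀ - z| ≤ M * h →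
      ∀ ε, 0 < ε → |recon κ r c s₁ s₂ ε x₀ h (gridData κ f x₀ h)
        - (fullPoly κ r x₀ h (gridData κ f x₀ h)).eval (x₀ + h / 2)| ≤ K * h ^ (2 * r - 1) := by
  by_cases hflat : ∀ t, 1 ≤ t → t < 2 * r - 1 → a t = 0
  · -- all substencil errors are already of the order `2 * r - 1`, whatever the weights are
    obtain ⟨K, hK, hKh⟩ := hf.exists_abs_subPoly_sub_le (r := r) κ (by omega) le_rfl hflat M
    refine ⟨r * (1 * K), by positivity, ?_⟩
    filter_upwards [hKh, self_mem_nhdsWithin] with h hKh hh x₀ hx₀ ε hε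
    refine (abs_recon_sub_fullPoly_le κ hc s₁ hs₂ hε x₀ hh _
      (fun i hi => abs_omegaWeight_sub_le_one κ hc hs₂ hε x₀ hh _ hi)
      (hKh x₀ hx₀)).trans_eq (by ring)
  · have hex : ∃ t, 1 ≤ t ∧ t < 2 * r - 1 ∧ a t ≠ 0 := by push Not at hflat; exact hflat
    classical
    obtain ⟨m, hm_def⟩ : ∃ m, m = Nat.find hex := ⟨_, rfl⟩
    obtain ⟨hm1, hm2, ham⟩ := hm_def ▸ Nat.find_spec hex
    have ha : ∀ t, 1 ≤ t → t < m → a t = 0 := by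
      intro t ht htm
      by_contra hne
      exact Nat.find_min hex (hm_def ▸ htm) ⟨ht, by omega, hne⟩
    obtain ⟨K₁, hK₁, h₁⟩ := hf.exists_abs_subPoly_sub_le (r := r) κ hm1 hm2.le ha M
    obtain ⟨K₂, hK₂, h₂⟩ := hf.exists_pow_le_smoothInd κ hr hm1 (by omega) ha ham M
    obtain ⟨e, he, hem, K₃, hK₃, h₃⟩ := hf.exists_min_le κ hr (by omega) ha M
    refine ⟨r * (s₂ * Real.exp s₂ * (K₃ * K₂) * K₁), by positivity, ?_⟩
    have hsmall : ∀ᶠ h in nhdsWithin (0 : ℝ) (Set.Ioi 0), K₃ * K₂ * h ^ e < 1 := by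
      refine nhdsWithin_le_nhds ?_
      have : Filter.Tendsto (fun h : ℝ => K₃ * K₂ * h ^ e) (nhds 0) (nhds 0) := by
        have := (by fun_prop : Continuous fun h : ℝ => K₃ * K₂ * h ^ e).tendsto 0
        simpa [zero_pow (by omega : e ≠ 0)] using this
      exact this.eventually_lt_const one_pos
    filter_upwards [h₁, h₂, h₃, hsmall, Ioo_mem_nhdsGT one_pos] with h h₁ h₂ h₃ hsmall ⟨hh, hh1⟩
      x₀ hx₀ ε hε
    have hI : ∀ i < r, 0 < smoothInd κ r x₀ h (gridData κ f x₀ h) i := fun i hi =>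
      pos_of_mul_pos_right ((pow_pos hh _).trans_le (h₂ x₀ hx₀ i hi)) hK₂
    have hmin : ∀ i < r, min (dOne r (gridData κ f x₀ h)) |dTwo κ r x₀ h (gridData κ f x₀ h)|
        ≤ K₃ * K₂ * h ^ e * smoothInd κ r x₀ h (gridData κ f x₀ h) i := fun i hi =>
      calc _ ≤ K₃ * h ^ (e + 2 * m) := h₃ x₀ hx₀
        _ = K₃ * h ^ e * h ^ (2 * m) := by rw [pow_add, mul_assoc]
        _ ≤ K₃ * h ^ e * (K₂ * smoothInd κ r x₀ h (gridData κ f x₀ h) i) := by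
          gcongr
          exact h₂ x₀ hx₀ i hi
        _ = _ := by ring
    refine (abs_recon_sub_fullPoly_le κ hc s₁ hs₂ hε x₀ hh _
      (fun i hi => abs_omegaWeight_sub_le κ hc hs₁ hs₂ hε x₀ hh _ (by positivity) hsmall.le hI
        hmin hi) (h₁ x₀ hx₀)).trans ?_
    calc _ = r * (s₂ * Real.exp s₂ * (K₃ * K₂) * K₁) * h ^ (e + m) := by rw [pow_add]; ring
      _ ≤ _ := by
        exact mul_le_mul_of_nonneg_left (pow_le_pow_of_le_one hh.le hh1.le hem) (by positivity)

end OWENO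

theorem mainTheorem1 (κ : OWENO.DataKind) (r : ℕ) (hr : 3 ≤ r) (s₁ s₂ : ℝ) (hs₁ : 1 ≤ s₁)
    (hs₂ : 0 < s₂) (c : ℕ → ℝ) (hc : OWENO.IsIdealWeights κ r c)
    (f : ℝ → ℝ) (z : ℝ) (hf : ContDiffAt ℝ ((2 * r - 1 : ℕ) : WithTop ℕ∞) f z) (M : ℝ) :
    ∃ K h₀ : ℝ, 0 < h₀ ∧ ∀ h x₀ ε : ℝ, 0 < h → h < h₀ → |x₀ - z| ≤ M * h → 0 < ε →
      |f (x₀ + h / 2) - OWENO.recon κ r c s₁ s₂ ε x₀ h (OWENO.gridData κ f x₀ h)|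
        ≤ K * (h ^ (2 * r - 1) + ε ^ s₂) := by
  obtain ⟨a, ha⟩ := OWENO.exists_hasTaylorExpansion hf
  obtain ⟨K₁, hK₁, h₁⟩ := ha.exists_abs_sub_fullPoly_le κ M
  obtain ⟨K₂, hK₂, h₂⟩ := ha.exists_abs_recon_sub_fullPoly_le κ hr hs₁ hs₂ hc M
  obtain ⟨h₀, hh₀, hsub⟩ := mem_nhdsGT_iff_exists_Ioo_subset.1 (h₁.and h₂)
  refine ⟨K₁ + K₂, h₀, hh₀, fun h x₀ ε hh hhh₀ hx₀ hε => ?_⟩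
  obtain ⟨e₁, e₂⟩ := hsub ⟨hh, hhh₀⟩
  calc |f (x₀ + h / 2) - OWENO.recon κ r c s₁ s₂ ε x₀ h (OWENO.gridData κ f x₀ h)|
      ≤ K₁ * h ^ (2 * r - 1) + K₂ * h ^ (2 * r - 1) := by
        have e₂' := e₂ x₀ hx₀ ε hε
        rw [abs_sub_comm] at e₂'
        exact (abs_sub_le _ _ _).trans (add_le_add (e₁ x₀ hx₀) e₂')
    _ = (K₁ + K₂) * (h ^ (2 * r - 1) + 0) := by ring
    _ ≤ (K₁ + K₂) * (h ^ (2 * r - 1) + ε ^ s₂) := by gcongr; positivity
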